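/- Let $(M,\omega)$ be a compact Kähler manifold of complex dimension $n$ with Kähler metric matrix $g=(g_{i\bar j})$ in local holomorphic coordinates $z^1,\dots,z^n$, and let $m\ge 2$ be an integer. Let $\varphi=\varphi^i_{\bar j}\,d\bar z^j\otimes\partial_i\in A^{0,1}(M,T^{1,0}M)$ be an integrable Beltrami differential, that is, $\varphi\bar\varphi$ has nowhere the eigenvalue $1$ and $\bar\partial\varphi=\frac12[\varphi,\varphi]$. Let $M_\varphi$ be the complex manifold with the same underlying smooth manifold as $M$ whose bundle of $(0,1)$-vectors is $\{v-\varphi(v): v\in T^{0,1}M\}$; its local holomorphic coordinates $w^k$ are thus smooth coordinates with $\bar\partial_j w^k=\varphi^i_{\bar j}\partial_i w^k$. For a smooth form $\sigma\in A^{n,0}(M,K_M^{\otimes(m-1)})$, locally $\sigma=f\,dz^1\wedge\dots\wedge dz^n\otimes(dz^1\wedge\dots\wedge dz^n)^{\otimes(m-1)}$, put $$\rho_\varphi(\sigma)=f\,\big((dz^1+\varphi\lrcorner dz^1)\wedge\dots\wedge(dz^n+\varphi\lrcorner dz^n)\big)^{\otimes m},$$ a smooth section of $K_{M_\varphi}^{\otimes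 m}$. It is holomorphic on $M_\varphi$ if in local holomorphic coordinates $w$ of $M_\varphi$ it is $h\,(dw^1\wedge\dots\wedge dw^n)^{\otimes m}$ with $h$ holomorphic; equivalently, if it is annihilated by the $\bar\partial$-operator of $K_{M_\varphi}^{\otimes m}$, given by $\bar\partial_\varphi(h\,\beta^{\otimes m})=0$ if and only if $dh\wedge\beta+m\,h\,d\beta=0$ for smooth functions $h$ and smooth local frames $\beta$ of $K_{M_\varphi}$. Let $\nabla'$ be the $(1,0)$-part of the Chern connection of $K_M^{\otimes(m-1)}$ with the induced metric $\det(g)^{-(m-1)}$, let $D=D'+\bar\partial$ be the Chern connection of $(T^{1,0}M,g)$, and let $\operatorname{div}\varphi=\operatorname{tr}(D'\varphi)\in A^{0,1}(M)$. Then, with either description of holomorphy, $\rho_\varphi(\sigma)$ is holomorphic on $M_\varphi$ if and only if $$\bar\partial\sigma=-\nabla'(\varphi\lrcorner\sigma)+(m-1)\operatorname{div}\varphi\wedge\sigma\qquad\text{on } M.$$ Moreover, on the domain of every local holomorphic coordinate system $z$ of $M$, the holomorphy of $\rho_\varphi(\sigma)$ (in either description) and this equation are each equivalent to $$\bar\partial_j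 f=\varphi^i_{\bar j}\,\partial_i f+m f\,\partial_i\varphi^i_{\bar j},\qquad j=1,\dots,n$$ (sums over repeated indices). -/

import Mathlib

open scoped Manifold ContDiff Matrix ComplexOrder TensorProduct

noncomputable section

namespace Pluricanonical

/-! ## Forms on the complex coordinate space -/

/-- The coordinate space `ℂⁿ`. -/
abbrev Cn (n : ℕ) : Type := Fin n → ℂ

/-- The complex valued `k`-covectors on `ℂⁿ`, seen as a real vector space:
the fibre of `Λᵏ T^*X ⊗ ℂ`, `X` being the underlying real manifold. -/
abbrev Cov (n k : ℕ) : Type := (Cn n) [⋀^Fin k]→L[ℝ] ℂ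

/-- The `i`-th standard basis vector, so that `stdVec i` is twice the real part of `∂_i`. -/
def stdVec {n : ℕ} (i : Fin n) : Cn n := Pi.single i 1

/-- The `ℂ`-linear part `½ (L v - i L (i v))` of a real linear map.
For `L = df` it is `∂f = ∑ ∂_i f dz^i`. -/
def linPart {n : ℕ} {F : Type*} [NormedAddCommGroup F] [NormedSpace ℝ F] [NormedSpace ℂ F]
    [SMulCommClass ℝ ℂ F] (L : Cn n →L[ℝ] F) : Cn n →L[ℝ] F :=
  (1 / 2 : ℂ) • (L - Complex.I •
    (L.comp ((Complex.I • ContinuousLinearMap.id ℂ (Cn n)).restrictScalars ℝ)))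

/-- The conjugate linear part `½ (L v + i L (i v))` of a real linear map.
For `L = df` it is `∂̄f = ∑ ∂̄_i f dz̄^i`. -/
def antiPart {n : ℕ} {F : Type*} [NormedAddCommGroup F] [NormedSpace ℝ F] [NormedSpace ℂ F]
    [SMulCommClass ℝ ℂ F] (L : Cn n →L[ℝ] F) : Cn n →L[ℝ] F :=
  (1 / 2 : ℂ) • (L + Complex.I •
    (L.comp ((Complex.I • ContinuousLinearMap.id ℂ (Cn n)).restrictScalars ℝ)))

/-- The Wirtinger derivative `∂_i` of a function or, coefficientwise, of a form. -/
def dz {n : ℕ} {F : Type*} [NormedAddCommGroup F] [NormedSpace ℝ F] [NormedSpace ℂ F]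
    [SMulCommClass ℝ ℂ F] (i : Fin n) (f : Cn n → F) (y : Cn n) : F :=
  linPart (fderiv ℝ f y) (stdVec i)

/-- The Wirtinger derivative `∂̄_j` of a function or, coefficientwise, of a form. -/
def dzbar {n : ℕ} {F : Type*} [NormedAddCommGroup F] [NormedSpace ℝ F] [NormedSpace ℂ F]
    [SMulCommClass ℝ ℂ F] (j : Fin n) (f : Cn n → F) (y : Cn n) : F :=
  antiPart (fderiv ℝ f y) (stdVec j)

/-- The operator `∂ = ∑ dz^i ∧ ∂_i` on forms: the exterior derivative, with the derivative
replaced by its `ℂ`-linear part. -/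
def del {n k : ℕ} (α : Cn n → Cov n k) (y : Cn n) : Cov n (k + 1) :=
  .alternatizeUncurryFin (linPart (fderiv ℝ α y))

/-- The operator `∂̄ = ∑ dz̄^j ∧ ∂̄_j` on forms. -/
def delbar {n k : ℕ} (α : Cn n → Cov n k) (y : Cn n) : Cov n (k + 1) :=
  .alternatizeUncurryFin (antiPart (fderiv ℝ α y))

/-- The wedge product `θ ∧ α` of a `1`-covector with a `k`-covector. -/
def wedge {n k : ℕ} (θ : Cn n →L[ℝ] ℂ) (α : Cov n k) : Cov n (k + 1) :=
  .alternatizeUncurryFin (θ.smulRight α)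

/-- A `1`-covector as an alternating map in one variable. -/
def toCov {n : ℕ} (θ : Cn n →L[ℝ] ℂ) : Cov n 1 :=
  ContinuousAlternatingMap.ofSubsingleton ℝ (Cn n) ℂ (0 : Fin 1) θ

/-- An alternating map in one variable as a `1`-covector. -/
def ofCov {n : ℕ} (α : Cov n 1) : Cn n →L[ℝ] ℂ :=
  (ContinuousAlternatingMap.ofSubsingleton ℝ (Cn n) ℂ (0 : Fin 1)).symm α

/-- Interior product with the `(1,0)`-vector `∂_i`, the covector being extended
complex linearly to complexified tangent vectors. -/
def contract {n k : ℕ} (i : Fin n) (α : Cov n (k + 1)) : Cov n k :=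
  linPart α.curryLeft (stdVec i)

/-- `α`, a covector of degree `p + q`, has type `(p,q)`: it scales as `λ^p λ̄^q`. -/
def IsOfType {n k : ℕ} (p q : ℕ) (α : Cov n k) : Prop :=
  k = p + q ∧ ∀ (a : ℂ) (v : Fin k → Cn n),
    α (fun i => a • v i) = a ^ p * (starRingEnd ℂ a) ^ q * α v

/-- The determinant, that is the covector `dz^1 ∧ ⋯ ∧ dz^n`. -/
def dZ (n : ℕ) : Cov n n :=
  ({ (Matrix.detRowAlternating : (Cn n) [⋀^Fin n]→ₗ[ℂ] ℂ) with
      cont := Continuous.matrix_det (A := fun v : Fin n → Cn n => Matrix.of v) (by fun_prop) } :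
    (Cn n) [⋀^Fin n]→L[ℂ] ℂ).restrictScalars ℝ

/-- The wedge product `ℓ^1 ∧ ⋯ ∧ ℓ^n` of `n` covectors: `(v_j) ↦ det (ℓ^i (v_j))`. -/
def wedgeAll {n : ℕ} (l : Fin n → (Cn n →L[ℝ] ℂ)) : Cov n n :=
  (dZ n).compContinuousLinearMap (ContinuousLinearMap.pi l)

/-- The covector `dz^i`. -/
def dzCov {n : ℕ} (i : Fin n) : Cn n →L[ℝ] ℂ :=
  ContinuousLinearMap.proj (R := ℝ) (φ := fun _ : Fin n => ℂ) i

/-- The covector `dz̄^j`. -/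
def dzbarCov {n : ℕ} (j : Fin n) : Cn n →L[ℝ] ℂ :=
  (Complex.conjCLE : ℂ →L[ℝ] ℂ).comp (dzCov j)

/-- The coefficient `f` of an `(n,0)`-covector `f dz^1 ∧ ⋯ ∧ dz^n`. -/
def coeff {n : ℕ} (α : Cov n n) : ℂ := α (fun i => stdVec i)

/-! ### Vector valued `(0,1)`-forms, in coordinates

A matrix function `Φ` stands for `∑ Φ i j dz̄^j ⊗ ∂_i`. -/

/-- The `(0,1)`-covector `φ^i = φ ⌟ dz^i = ∑_j φ^i_{j̄} dz̄^j`. -/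
def comp01 {n : ℕ} (Φ : Matrix (Fin n) (Fin n) ℂ) (i : Fin n) : Cn n →L[ℝ] ℂ :=
  ∑ j, Φ i j • dzbarCov j

/-- The contraction `φ ⌟ α = ∑_i φ^i ∧ (∂_i ⌟ α)`, which is zero on functions. -/
def contraction {n : ℕ} (Φ : Matrix (Fin n) (Fin n) ℂ) : {k : ℕ} → Cov n k → Cov n k
  | 0, _ => 0
  | _ + 1, α => ∑ i, wedge (comp01 Φ i) (contract i α)

/-- The `j`-th component of the bracket `[φ,ψ]` of two `T^{1,0}`-valued `(0,1)`-forms: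
`∑_i (φ^i ∧ ∂_i ψ^j + ψ^i ∧ ∂_i φ^j)`. -/
def bracket {n : ℕ} (Φ Ψ : Cn n → Matrix (Fin n) (Fin n) ℂ) (j : Fin n) (y : Cn n) : Cov n 2 :=
  ∑ i, (wedge (comp01 (Φ y) i) (dz i (fun x => toCov (comp01 (Ψ x) j)) y)
    + wedge (comp01 (Ψ y) i) (dz i (fun x => toCov (comp01 (Φ x) j)) y))

/-- The covector `(dz^1 + φ dz^1) ∧ ⋯ ∧ (dz^n + φ dz^n)`, which spans the fibre of the canonical
bundle `K_{M_φ}`. -/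
def frame {n : ℕ} (Φ : Matrix (Fin n) (Fin n) ℂ) : Cov n n :=
  wedgeAll (fun i => dzCov i + comp01 Φ i)

/-! ## Geometric objects on a complex manifold

`M` is a complex manifold of dimension `n`. Tensors on `M` are given by their expressions in all
local holomorphic coordinate systems (the charts of the maximal atlas), which have to be smooth
and to transform as they should. The values outside of the domains of the charts are irrelevant. -/

section Manifold

variable (n : ℕ) (M : Type*) [TopologicalSpace M] [ChartedSpace (Cn n) M]

/-- The local holomorphic coordinate systems of `M`. -/
def holCharts : Set (OpenPartialHomeomorph M (Cn n)) :=
  IsManifold.maximalAtlas 𝓘(ℂ, Cn n) ω M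

variable {n M}

/-- The Jacobian matrix `∂z'^i / ∂z^j` of a change of holomorphic coordinates. -/
def jac (c c' : OpenPartialHomeomorph M (Cn n)) (y : Cn n) : Matrix (Fin n) (Fin n) ℂ :=
  Matrix.of fun i j => fderiv ℂ (fun z => c' (c.symm z)) y (stdVec j) i

variable (n M)

/-- A Kähler metric `∑ g_{i j̄} dz^i ⊗ dz̄^j` on `M`. -/
structure KahlerMetric where
  /-- the matrix `(g_{i j̄})` in a coordinate system -/
  rep : OpenPartialHomeomorph M (Cn n) → Cn n → Matrix (Fin n) (Fin n) ℂ
  smooth : ∀ c ∈ holCharts n M, ∀ i j, ContDiffOn ℝ ∞ (fun y => rep c y i j) c.target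
  posDef : ∀ c ∈ holCharts n M, ∀ y ∈ c.target, (rep c y).PosDef
  transform : ∀ c ∈ holCharts n M, ∀ c' ∈ holCharts n M, ∀ x ∈ c.source ∩ c'.source,
    rep c (c x) = (jac c c' (c x))ᵀ * rep c' (c' x) * (jac c c' (c x)).map (starRingEnd ℂ)
  /-- closedness of the associated `(1,1)`-form -/
  kahler : ∀ c ∈ holCharts n M, ∀ y ∈ c.target, ∀ i k l,
    dz k (fun z => rep c z i l) y = dz i (fun z => rep c z k l) y

/-- A smooth `T^{1,0}M`-valued `(0,1)`-form `φ = ∑ φ^i_{j̄} dz̄^j ⊗ ∂_i` on `M`. -/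
structure VectorForm where
  /-- the matrix `(φ^i_{j̄})` in a coordinate system -/
  rep : OpenPartialHomeomorph M (Cn n) → Cn n → Matrix (Fin n) (Fin n) ℂ
  smooth : ∀ c ∈ holCharts n M, ∀ i j, ContDiffOn ℝ ∞ (fun y => rep c y i j) c.target
  transform : ∀ c ∈ holCharts n M, ∀ c' ∈ holCharts n M, ∀ x ∈ c.source ∩ c'.source,
    rep c' (c' x) * (jac c c' (c x)).map (starRingEnd ℂ) = jac c c' (c x) * rep c (c x)

/-- A smooth `k`-form on `M` with values in the line bundle `K_M^{⊗ r}`. In the coordinates `z`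
it is written `α ⊗ (dz^1 ∧ ⋯ ∧ dz^n)^{⊗ r}`, where `rep` gives `α`. -/
structure TwistedForm (r k : ℕ) where
  /-- the form `α` in a coordinate system -/
  rep : OpenPartialHomeomorph M (Cn n) → Cn n → Cov n k
  smooth : ∀ c ∈ holCharts n M, ContDiffOn ℝ ∞ (rep c) c.target
  transform : ∀ c ∈ holCharts n M, ∀ c' ∈ holCharts n M, ∀ x ∈ c.source ∩ c'.source,
    rep c (c x) = (jac c c' (c x)).det ^ r •
      (rep c' (c' x)).compContinuousLinearMap
        ((fderiv ℂ (fun z => c' (c.symm z)) (c x)).restrictScalars ℝ)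

variable {n M}

/-- The form is of type `(p,q)`, that is, it belongs to `A^{p,q}(M, K_M^{⊗ r})`. -/
def TwistedForm.HasType {r k : ℕ} (σ : TwistedForm n M r k) (p q : ℕ) : Prop :=
  ∀ c ∈ holCharts n M, ∀ y ∈ c.target, IsOfType p q (σ.rep c y)

/-- `φ` is a Beltrami differential: `φ φ̄` does not have the eigenvalue `1` at any point. -/
def VectorForm.IsBeltrami (φ : VectorForm n M) : Prop :=
  ∀ c ∈ holCharts n M, ∀ y ∈ c.target,
    ¬ Module.End.HasEigenvalue
      (Matrix.toLin' (φ.rep c y * (φ.rep c y).map (starRingEnd ℂ))) 1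

/-- The integrability condition `∂̄φ = ½ [φ,φ]`. -/
def VectorForm.IsIntegrable (φ : VectorForm n M) : Prop :=
  ∀ c ∈ holCharts n M, ∀ y ∈ c.target, ∀ i,
    delbar (fun x => toCov (comp01 (φ.rep c x) i)) y
      = (1 / 2 : ℂ) • bracket (φ.rep c) (φ.rep c) i y

/-! ### Chern connections and divergence -/

/-- The `(i,p)`-entry of the connection matrix `θ = ∂g g⁻¹` of the Chern connection
of `T^{1,0}M`. -/
def KahlerMetric.connForm (g : KahlerMetric n M) (c : OpenPartialHomeomorph M (Cn n))
    (i p : Fin n) (y : Cn n) : Cn n →L[ℝ] ℂ :=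
  ∑ l, (g.rep c y)⁻¹ l p • linPart (fderiv ℝ (fun z => g.rep c z i l) y)

/-- The `∂_p`-component of `D'φ`, where `D = D' + ∂̄` is the Chern connection of `T^{1,0}M`:
`(D'φ)^p = ∂φ^p - ∑_i φ^i ∧ θ_i^p`. -/
def dPrime (g : KahlerMetric n M) (φ : VectorForm n M) (c : OpenPartialHomeomorph M (Cn n))
    (p : Fin n) (y : Cn n) : Cov n 2 :=
  del (fun x => toCov (comp01 (φ.rep c x) p)) y
    - ∑ i, wedge (comp01 (φ.rep c y) i) (toCov (g.connForm c i p y))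

/-- The divergence `div φ = tr (D'φ)`, a `(0,1)`-form; the trace contracts the vector part
`∂_p` with the form part. -/
def divergence (g : KahlerMetric n M) (φ : VectorForm n M)
    (c : OpenPartialHomeomorph M (Cn n)) (y : Cn n) : Cn n →L[ℝ] ℂ :=
  ofCov (∑ p, contract p (dPrime g φ c p y))

/-- The induced metric `det(g)^{-r}` of `K_M^{⊗ r}`, in the frame `(dz^1 ∧ ⋯ ∧ dz^n)^{⊗ r}`. -/
def bundleMetric (g : KahlerMetric n M) (r : ℕ) (c : OpenPartialHomeomorph M (Cn n))
    (y : Cn n) : ℂ :=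
  ((g.rep c y).det ^ r)⁻¹

/-- The `(1,0)`-part `∇'` of the Chern connection of `(K_M^{⊗ r}, h)`, `h = det(g)^{-r}`, on
bundle valued forms: `∇'(α ⊗ e) = (∂α + h⁻¹ ∂h ∧ α) ⊗ e`. -/
def nablaPrime (g : KahlerMetric n M) (r : ℕ) (c : OpenPartialHomeomorph M (Cn n)) {k : ℕ}
    (α : Cn n → Cov n k) (y : Cn n) : Cov n (k + 1) :=
  del α y + wedge ((bundleMetric g r c y)⁻¹ • linPart (fderiv ℝ (bundleMetric g r c) y)) (α y)

/-- The equation `∂̄σ = -∇'(φ ⌟ σ) + (m-1) div φ ∧ σ` in the domain of a chart. -/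
def ExtensionEqOn (g : KahlerMetric n M) (φ : VectorForm n M) (m : ℕ)
    (σ : TwistedForm n M (m - 1) n) (c : OpenPartialHomeomorph M (Cn n)) : Prop :=
  ∀ y ∈ c.target,
    delbar (σ.rep c) y
      = - nablaPrime g (m - 1) c (fun x => contraction (φ.rep c x) (σ.rep c x)) y
        + ((m : ℂ) - 1) • wedge (divergence g φ c y) (σ.rep c y)

/-- The equation `∂̄σ = -∇'(φ ⌟ σ) + (m-1) div φ ∧ σ` on `M`. -/
def ExtensionEq (g : KahlerMetric n M) (φ : VectorForm n M) (m : ℕ)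
    (σ : TwistedForm n M (m - 1) n) : Prop :=
  ∀ c ∈ holCharts n M, ExtensionEqOn g φ m σ c

/-- The equations `∂̄_j f = φ^i_{j̄} ∂_i f + m f ∂_i φ^i_{j̄}` in the domain of a chart, where
`σ = f dz^1 ∧ ⋯ ∧ dz^n ⊗ (dz^1 ∧ ⋯ ∧ dz^n)^{⊗ (m-1)}`. -/
def LocalEqOn (φ : VectorForm n M) (m : ℕ) (σ : TwistedForm n M (m - 1) n)
    (c : OpenPartialHomeomorph M (Cn n)) : Prop :=
  ∀ y ∈ c.target, ∀ j : Fin n,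
    dzbar j (fun x => coeff (σ.rep c x)) y
      = ∑ i, φ.rep c y i j * dz i (fun x => coeff (σ.rep c x)) y
        + m * coeff (σ.rep c y) * ∑ i, dz i (fun x => φ.rep c x i j) y

/-! ### The deformed complex manifold and its pluricanonical forms -/

/-- `ρ_φ(σ) = f ((dz^1 + φ dz^1) ∧ ⋯ ∧ (dz^n + φ dz^n))^{⊗ m}`, a section of the `m`-th tensor
power of the bundle of complex valued `n`-covectors, in the coordinates of a chart. -/
def rho (φ : VectorForm n M) (m : ℕ) (σ : TwistedForm n M (m - 1) n)
    (c : OpenPartialHomeomorph M (Cn n)) (y : Cn n) : ⨂[ℂ]^m (Cov n n) :=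
  coeff (σ.rep c y) • PiTensorProduct.tprod ℂ (fun _ : Fin m => frame (φ.rep c y))

/-- A structure of complex manifold of dimension `n` on a topological space. -/
structure ComplexStructure (n : ℕ) (X : Type*) [TopologicalSpace X] where
  /-- the holomorphic atlas -/
  charted : ChartedSpace (Cn n) X
  isManifold : IsManifold 𝓘(ℂ, Cn n) ω X

/-- The complex manifold structure `A` on the space `M` is the deformed complex manifold `M_φ`:
it has the same underlying smooth manifold, and its `(0,1)`-vectors are `v - φ(v)`, with `v` a
`(0,1)`-vector of `M`. The latter says that the coordinates `w` of `A` satisfy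
`∂̄_j w^k = φ^i_{j̄} ∂_i w^k`. -/
structure IsDeformation (φ : VectorForm n M) (A : ComplexStructure n M) : Prop where
  smooth : ∀ w ∈ A.charted.atlas, ∀ c ∈ holCharts n M,
    ContDiffOn ℝ ∞ (fun y => w (c.symm y)) (c.symm.trans w).source ∧
    ContDiffOn ℝ ∞ (fun y => c (w.symm y)) (w.symm.trans c).source
  tangent : ∀ w ∈ A.charted.atlas, ∀ c ∈ holCharts n M, ∀ y ∈ (c.symm.trans w).source, ∀ j k,
    dzbar j (fun x => w (c.symm x) k) y
      = ∑ i, φ.rep c y i j * dz i (fun x => w (c.symm x) k) y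

/-- The covector `dw^1 ∧ ⋯ ∧ dw^n` at a point, in the coordinates of the chart `c`. -/
def dW (w c : OpenPartialHomeomorph M (Cn n)) (y : Cn n) : Cov n n :=
  (dZ n).compContinuousLinearMap (fderiv ℝ (fun x => w (c.symm x)) y)

/-- The section `τ` of the `m`-th tensor power of the bundle of complex valued `n`-covectors is,
over `U`, a holomorphic pluricanonical form of the complex manifold structure `A`: in the
coordinates `w` of `A` it reads `h (dw^1 ∧ ⋯ ∧ dw^n)^{⊗ m}` with `h` holomorphic. -/
def IsHolomorphicOn (A : ComplexStructure n M) (m : ℕ)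
    (τ : OpenPartialHomeomorph M (Cn n) → Cn n → ⨂[ℂ]^m (Cov n n)) (U : Set M) : Prop :=
  ∀ w ∈ A.charted.atlas, ∃ h : Cn n → ℂ,
    DifferentiableOn ℂ h (w.target ∩ w.symm ⁻¹' U) ∧
    ∀ c ∈ holCharts n M, ∀ x ∈ U ∩ (c.source ∩ w.source),
      τ c (c x) = h (w x) • PiTensorProduct.tprod ℂ (fun _ : Fin m => dW w c (c x))

/-- Over the domain of the chart `c`, the section `τ` of `K_{M_φ}^{⊗ m}` is annihilated by the
`∂̄`-operator of `K_{M_φ}^{⊗ m}`. Near every point `τ = h β^{⊗ m}`, with `h` a smooth function and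
`β` a smooth frame of `K_{M_φ}`; as `∂̄_φ β = dβ` and `∂̄_φ h ∧ β = dh ∧ β` by type, the equation
`∂̄_φ τ = 0` reads `dh ∧ β + m h dβ = 0`, for one and hence for every choice of `β`. -/
def IsDbarClosedOn (φ : VectorForm n M) (m : ℕ)
    (τ : OpenPartialHomeomorph M (Cn n) → Cn n → ⨂[ℂ]^m (Cov n n))
    (c : OpenPartialHomeomorph M (Cn n)) : Prop :=
  ∀ y₀ ∈ c.target, ∃ W : Set (Cn n), IsOpen W ∧ y₀ ∈ W ∧ W ⊆ c.target ∧
    ∃ (h : Cn n → ℂ) (β : Cn n → Cov n n),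
      ContDiffOn ℝ ∞ h W ∧ ContDiffOn ℝ ∞ β W ∧
      ∀ y ∈ W, β y ≠ 0 ∧ β y ∈ Submodule.span ℂ {frame (φ.rep c y)} ∧
        τ c y = h y • PiTensorProduct.tprod ℂ (fun _ : Fin m => β y) ∧
        wedge (fderiv ℝ h y) (β y) + ((m : ℂ) * h y) • extDeriv β y = 0

end Manifold

end Pluricanonical

end

open Pluricanonical

/-!
The proof works in one holomorphic chart `c` of `M` at a time, with `dz^i`, `dz̄^i` the coordinate
covectors, `e^i = dz^i + φ^i` the coframe of `M_φ` and `F = e^1 ∧ ⋯ ∧ e^n` the frame of `K_{M_φ}`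
(`coframe`, `frame`). A form of type `(n,0)` is `σ = f dz^1 ∧ ⋯ ∧ dz^n`
(`IsOfType.eq_coeff_smul_dZ`), and each of the three conditions on `σ` is compared with the local
equation `L_j f = m f ∑_i ∂_i φ^i_{j̄}`, where `L_j = ∂̄_j - φ^i_{j̄} ∂_i` are the vector fields of
type `(0,1)` of `M_φ`.

*The extension equation* (`extensionEqOn_iff_localEqOn`). Both sides are combinations of the
covectors `dz̄^j ∧ dz^1 ∧ ⋯ ∧ dz^n`. The metric enters through the connection form
`-(m-1) ∂ log det g` of `∇'` (`bundleMetric_connection`) and through `div φ`, whose coefficients are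
`∑_i (∂_i φ^i_{j̄} + φ^i_{j̄} ∂_i log det g)` by the Kähler condition and Jacobi's formula
(`KahlerMetric.sum_connForm`, `divergence_eq`); the two contributions of `log det g` cancel.

*The `∂̄`-operator of `M_φ`* (`isDbarClosedOn_iff_localEqOn`). Integrability of `φ` says that
`dφ^i = ∑_l e^l ∧ ∂_l φ^i`, whence `dF = -∑_j (∑_i ∂_i φ^i_{j̄}) dz̄^j ∧ F` (`extDeriv_frame`), while
`df ∧ F = ∑_j (L_j f) dz̄^j ∧ F` (`wedge_frame`). The covectors `dz̄^j ∧ F` are linearly independent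
because `F ≠ 0`, which is the Beltrami condition (`frame_ne_zero`). The equation does not depend on
the frame of `K_{M_φ}`.

*Holomorphic coordinates of `M_φ`* (`isHolomorphicOn_source_iff_localEqOn`). If `L_j w^k = 0`, then
`dw^1 ∧ ⋯ ∧ dw^n = det(∂w) F` (`dZ_comp_fderiv`), so that `ρ_φ(σ) = h (dw^1 ∧ ⋯ ∧ dw^n)^{⊗ m}`
means `f = (h ∘ w) det(∂w)^m`. Commuting `L_j` with `∂_l` gives
`L_j det(∂w) = (∑_i ∂_i φ^i_{j̄}) det(∂w)` (`dzbar_det_holJac`), so the local equation for `f`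
becomes `L_j (h ∘ w) = 0`, which says that `h` is holomorphic (`dzbar_comp_eq_iff`). Since `h` is
determined by the section, holomorphy is a local condition on `M` (`isHolomorphicOn_univ_iff`).
-/

noncomputable section

namespace Pluricanonical

/-! ### Linear and conjugate linear parts -/

section Parts

variable {n : ℕ} {F : Type*} [NormedAddCommGroup F] [NormedSpace ℝ F] [NormedSpace ℂ F]
  [IsScalarTower ℝ ℂ F]

theorem linPart_apply (L : Cn n →L[ℝ] F) (v : Cn n) :
    linPart L v = (1 / 2 : ℂ) • (L v - Complex.I • L (Complex.I • v)) := rfl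

theorem antiPart_apply (L : Cn n →L[ℝ] F) (v : Cn n) :
    antiPart L v = (1 / 2 : ℂ) • (L v + Complex.I • L (Complex.I • v)) := rfl

theorem linPart_add_antiPart (L : Cn n →L[ℝ] F) : linPart L + antiPart L = L := by
  ext v
  simp only [_root_.add_apply, linPart_apply, antiPart_apply]
  module

theorem linPart_smul_apply (L : Cn n →L[ℝ] F) (a : ℂ) (v : Cn n) :
    linPart L (a • v) = a • linPart L v := by
  have h1 : a • v = a.re • v + a.im • (Complex.I • v) := by
    rw [← Complex.coe_smul, ← Complex.coe_smul, smul_smul, ← add_smul, Complex.re_add_im]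
  have h2 : Complex.I • a • v = a.re • (Complex.I • v) - a.im • v := by
    rw [← Complex.coe_smul, ← Complex.coe_smul, smul_smul, smul_smul, ← sub_smul]
    congr 1
    apply Complex.ext <;> simp
  have h4 (r : ℝ) (x : F) : r • x = (r : ℂ) • x := (algebraMap_smul ℂ r x).symm
  have h3 (x : F) : a • x = a.re • x + a.im • (Complex.I • x) := by
    rw [h4, h4, smul_smul, ← add_smul, Complex.re_add_im]
  have hI (x : F) : Complex.I • Complex.I • x = -x := by simp [smul_smul]
  rw [linPart_apply, linPart_apply, h2, h1]
  simp only [map_add, map_sub, map_smul, h3, smul_sub, smul_add, h4, hI, smul_neg,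
    smul_comm Complex.I]
  module

theorem antiPart_smul_apply (L : Cn n →L[ℝ] F) (a : ℂ) (v : Cn n) :
    antiPart L (a • v) = (starRingEnd ℂ a) • antiPart L v := by
  have h1 : a • v = a.re • v + a.im • (Complex.I • v) := by
    rw [← Complex.coe_smul, ← Complex.coe_smul, smul_smul, ← add_smul, Complex.re_add_im]
  have h2 : Complex.I • a • v = a.re • (Complex.I • v) - a.im • v := by
    rw [← Complex.coe_smul, ← Complex.coe_smul, smul_smul, smul_smul, ← sub_smul]
    congr 1
    apply Complex.ext <;> simp
  have h4 (r : ℝ) (x : F) : r • x = (r : ℂ) • x := (algebraMap_smul ℂ r x).symm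
  have h3 (x : F) : (starRingEnd ℂ a) • x = a.re • x - a.im • (Complex.I • x) := by
    rw [h4, h4, smul_smul, ← sub_smul]
    congr 1
    apply Complex.ext <;> simp
  have hI (x : F) : Complex.I • Complex.I • x = -x := by simp [smul_smul]
  rw [antiPart_apply, antiPart_apply, h2, h1]
  simp only [map_add, map_sub, map_smul, h3, smul_sub, smul_add, h4, hI, smul_neg,
    smul_comm Complex.I]
  module

theorem eq_sum_smul_stdVec (v : Cn n) : v = ∑ i, v i • stdVec i := by
  ext j
  simp [stdVec, Pi.single_apply]

theorem linPart_eq_sum (L : Cn n →L[ℝ] F) (v : Cn n) :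
    linPart L v = ∑ i, v i • linPart L (stdVec i) := by
  conv_lhs => rw [eq_sum_smul_stdVec v]
  simp only [map_sum, linPart_smul_apply]

theorem antiPart_eq_sum (L : Cn n →L[ℝ] F) (v : Cn n) :
    antiPart L v = ∑ i, (starRingEnd ℂ (v i)) • antiPart L (stdVec i) := by
  conv_lhs => rw [eq_sum_smul_stdVec v]
  simp only [map_sum, antiPart_smul_apply]

/-- A real linear map is determined by its values on the complex vectors `∂_i` and `∂̄_i`. -/
theorem apply_eq_sum (L : Cn n →L[ℝ] F) (v : Cn n) :
    L v = ∑ i, v i • linPart L (stdVec i)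
      + ∑ i, (starRingEnd ℂ (v i)) • antiPart L (stdVec i) := by
  rw [← linPart_eq_sum, ← antiPart_eq_sum, ← _root_.add_apply, linPart_add_antiPart]

@[simp] theorem linPart_add (L K : Cn n →L[ℝ] F) : linPart (L + K) = linPart L + linPart K := by
  ext v; simp only [linPart_apply, _root_.add_apply]; module

@[simp] theorem antiPart_add (L K : Cn n →L[ℝ] F) :
    antiPart (L + K) = antiPart L + antiPart K := by
  ext v; simp only [antiPart_apply, _root_.add_apply]; module

@[simp] theorem linPart_smul (a : ℂ) (L : Cn n →L[ℝ] F) : linPart (a • L) = a • linPart L := by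
  ext v; simp only [linPart_apply, _root_.smul_apply]; module

@[simp] theorem antiPart_smul (a : ℂ) (L : Cn n →L[ℝ] F) : antiPart (a • L) = a • antiPart L := by
  ext v; simp only [antiPart_apply, _root_.smul_apply]; module

@[simp] theorem linPart_zero : linPart (0 : Cn n →L[ℝ] F) = 0 := by
  ext v; simp [linPart_apply]

@[simp] theorem antiPart_zero : antiPart (0 : Cn n →L[ℝ] F) = 0 := by
  ext v; simp [antiPart_apply]

@[simp] theorem linPart_sum {ι : Type*} (s : Finset ι) (L : ι → Cn n →L[ℝ] F) :
    linPart (∑ i ∈ s, L i) = ∑ i ∈ s, linPart (L i) := by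
  classical
  induction s using Finset.induction_on with
  | empty => simp
  | insert a s ha ih => simp [Finset.sum_insert ha, ih]

@[simp] theorem antiPart_sum {ι : Type*} (s : Finset ι) (L : ι → Cn n →L[ℝ] F) :
    antiPart (∑ i ∈ s, L i) = ∑ i ∈ s, antiPart (L i) := by
  classical
  induction s using Finset.induction_on with
  | empty => simp
  | insert a s ha ih => simp [Finset.sum_insert ha, ih]

theorem linPart_smulRight (θ : Cn n →L[ℝ] ℂ) (x : F) (v : Cn n) :
    linPart (θ.smulRight x) v = linPart θ v • x := by
  simp only [linPart_apply, ContinuousLinearMap.smulRight_apply, smul_eq_mul]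
  module

theorem antiPart_smulRight (θ : Cn n →L[ℝ] ℂ) (x : F) (v : Cn n) :
    antiPart (θ.smulRight x) v = antiPart θ v • x := by
  simp only [antiPart_apply, ContinuousLinearMap.smulRight_apply, smul_eq_mul]
  module

theorem linPart_linPart (L : Cn n →L[ℝ] F) : linPart (linPart L) = linPart L := by
  ext v
  rw [linPart_apply, linPart_smul_apply]
  simp only [smul_smul, Complex.I_mul_I]
  module

theorem antiPart_linPart (L : Cn n →L[ℝ] F) : antiPart (linPart L) = 0 := by
  ext v
  rw [antiPart_apply, linPart_smul_apply]
  simp only [smul_smul, Complex.I_mul_I]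
  simp

theorem linPart_antiPart (L : Cn n →L[ℝ] F) : linPart (antiPart L) = 0 := by
  ext v
  rw [linPart_apply, antiPart_smul_apply]
  simp [smul_smul]

theorem antiPart_antiPart (L : Cn n →L[ℝ] F) : antiPart (antiPart L) = antiPart L := by
  ext v
  rw [antiPart_apply, antiPart_smul_apply]
  simp only [smul_smul, Complex.conj_I, mul_neg, Complex.I_mul_I]
  module

end Parts

section Covectors

variable {n : ℕ}

@[simp] theorem dzCov_apply (i : Fin n) (v : Cn n) : dzCov i v = v i := rfl

@[simp] theorem dzbarCov_apply (i : Fin n) (v : Cn n) :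
    dzbarCov i v = starRingEnd ℂ (v i) := rfl

theorem stdVec_apply (i j : Fin n) : (stdVec i : Cn n) j = if j = i then 1 else 0 := by
  simp [stdVec, Pi.single_apply]

/-- The instance of `zero_smul` for covectors, which `simp` does not find through the action of `ℂ`
on real linear maps. -/
@[simp] theorem covector_zero_smul (θ : Cn n →L[ℝ] ℂ) : (0 : ℂ) • θ = 0 := zero_smul ℂ θ

@[simp] theorem linPart_dzCov (i j : Fin n) :
    linPart (dzCov i) (stdVec j) = if i = j then 1 else 0 := by
  simp only [linPart_apply, dzCov_apply, Pi.smul_apply, stdVec_apply]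
  split_ifs <;> simp
  norm_num

@[simp] theorem antiPart_dzCov (i j : Fin n) : antiPart (dzCov i) (stdVec j) = 0 := by
  simp only [antiPart_apply, dzCov_apply, Pi.smul_apply, stdVec_apply]
  split_ifs <;> simp

@[simp] theorem linPart_dzbarCov (i j : Fin n) : linPart (dzbarCov i) (stdVec j) = 0 := by
  simp only [linPart_apply, dzbarCov_apply, Pi.smul_apply, stdVec_apply]
  split_ifs <;> simp

@[simp] theorem antiPart_dzbarCov (i j : Fin n) :
    antiPart (dzbarCov i) (stdVec j) = if i = j then 1 else 0 := by
  simp only [antiPart_apply, dzbarCov_apply, Pi.smul_apply, stdVec_apply]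
  split_ifs <;> simp
  norm_num

/-- A `1`-covector is the combination of the `dz^i` and `dz̄^i` with coefficients its values on
the dual vectors. -/
theorem eq_sum_dzCov (θ : Cn n →L[ℝ] ℂ) :
    θ = ∑ i, linPart θ (stdVec i) • dzCov i + ∑ i, antiPart θ (stdVec i) • dzbarCov i := by
  ext v
  rw [apply_eq_sum θ v]
  simp [mul_comm]

theorem comp01_apply (Φ : Matrix (Fin n) (Fin n) ℂ) (i : Fin n) (v : Cn n) :
    comp01 Φ i v = ∑ j, Φ i j * starRingEnd ℂ (v j) := by
  simp [comp01]

@[simp] theorem linPart_comp01 (Φ : Matrix (Fin n) (Fin n) ℂ) (i j : Fin n) :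
    linPart (comp01 Φ i) (stdVec j) = 0 := by
  simp [comp01]

@[simp] theorem antiPart_comp01 (Φ : Matrix (Fin n) (Fin n) ℂ) (i j : Fin n) :
    antiPart (comp01 Φ i) (stdVec j) = Φ i j := by
  simp [comp01]

end Covectors

/-! ### The wedge product with a covector -/

section Wedge

variable {n k : ℕ}

/-! The action of `ℂ` on covectors over `ℝ` is not unified, at reducible transparency, with the one
of a `ℂ`-module. The module identities are restated so that `rw` and `simp` apply them. -/

@[simp] theorem cov_zero_smul (α : Cov n k) : (0 : ℂ) • α = 0 := zero_smul ℂ α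

theorem cov_add_smul (a b : ℂ) (α : Cov n k) : (a + b) • α = a • α + b • α := add_smul a b α

theorem cov_sub_smul (a b : ℂ) (α : Cov n k) : (a - b) • α = a • α - b • α := sub_smul a b α

theorem cov_neg_smul (a : ℂ) (α : Cov n k) : (-a) • α = -(a • α) := neg_smul a α

theorem cov_sum_smul {ι : Type*} (s : Finset ι) (a : ι → ℂ) (α : Cov n k) :
    (∑ p ∈ s, a p) • α = ∑ p ∈ s, a p • α := by
  ext v
  simp [Finset.sum_mul]

@[simp] theorem cov_smul_zero (a : ℂ) : a • (0 : Cov n k) = 0 := by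
  ext v; simp

theorem eq_zero_of_cov_smul_eq_zero {a : ℂ} {α : Cov n k} (h : a • α = 0) (hα : α ≠ 0) :
    a = 0 := by
  by_contra ha
  apply hα
  ext v
  have hv : a * α v = 0 := congrArg (fun β : Cov n k => β v) h
  exact (mul_eq_zero.mp hv).resolve_left ha

theorem wedge_apply (θ : Cn n →L[ℝ] ℂ) (α : Cov n k) (v : Fin (k + 1) → Cn n) :
    wedge θ α v = ∑ i : Fin (k + 1), (-1) ^ (i : ℕ) * (θ (v i) * α (Fin.removeNth i v)) := by
  simp [wedge, ContinuousAlternatingMap.alternatizeUncurryFin_apply, zsmul_eq_mul]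

theorem wedge_add (θ : Cn n →L[ℝ] ℂ) (α β : Cov n k) :
    wedge θ (α + β) = wedge θ α + wedge θ β := by
  ext v; simp [wedge_apply, mul_add, Finset.sum_add_distrib]

theorem add_wedge (θ η : Cn n →L[ℝ] ℂ) (α : Cov n k) :
    wedge (θ + η) α = wedge θ α + wedge η α := by
  ext v; simp [wedge_apply, mul_add, add_mul, Finset.sum_add_distrib]

theorem wedge_smul (a : ℂ) (θ : Cn n →L[ℝ] ℂ) (α : Cov n k) :
    wedge θ (a • α) = a • wedge θ α := by
  ext v
  simp only [wedge_apply, ContinuousAlternatingMap.smul_apply, smul_eq_mul, Finset.mul_sum]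
  exact Finset.sum_congr rfl fun i _ => by ring

theorem smul_wedge (a : ℂ) (θ : Cn n →L[ℝ] ℂ) (α : Cov n k) :
    wedge (a • θ) α = a • wedge θ α := by
  ext v
  simp only [wedge_apply, ContinuousAlternatingMap.smul_apply, _root_.smul_apply,
    smul_eq_mul, Finset.mul_sum]
  exact Finset.sum_congr rfl fun i _ => by ring

@[simp] theorem wedge_zero (θ : Cn n →L[ℝ] ℂ) : wedge θ (0 : Cov n k) = 0 := by
  ext v; simp [wedge_apply]

@[simp] theorem zero_wedge (α : Cov n k) : wedge 0 α = 0 := by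
  ext v; simp [wedge_apply]

theorem wedge_sum {ι : Type*} (s : Finset ι) (θ : Cn n →L[ℝ] ℂ) (α : ι → Cov n k) :
    wedge θ (∑ i ∈ s, α i) = ∑ i ∈ s, wedge θ (α i) := by
  classical
  induction s using Finset.induction_on with
  | empty => simp
  | insert a s ha ih => simp [Finset.sum_insert ha, ih, wedge_add]

theorem sum_wedge {ι : Type*} (s : Finset ι) (θ : ι → Cn n →L[ℝ] ℂ) (α : Cov n k) :
    wedge (∑ i ∈ s, θ i) α = ∑ i ∈ s, wedge (θ i) α := by
  classical
  induction s using Finset.induction_on with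
  | empty => simp
  | insert a s ha ih => simp [Finset.sum_insert ha, ih, add_wedge]

theorem wedge_neg (θ : Cn n →L[ℝ] ℂ) (α : Cov n k) : wedge θ (-α) = -wedge θ α := by
  ext v; simp [wedge_apply]

/-- The double wedge product is the double alternatization of the symmetric bilinear map
`x, y ↦ θ(x) θ(y) α`. -/
theorem wedge_wedge_self (θ : Cn n →L[ℝ] ℂ) (α : Cov n k) : wedge θ (wedge θ α) = 0 := by
  have h := ContinuousAlternatingMap.alternatizeUncurryFin_alternatizeUncurryFinCLM_comp_of_symmetric
    (𝕜 := ℝ) (E := Cn n) (F := ℂ) (n := k)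
    (f := (LinearMap.toContinuousLinearMap
      { toFun := fun x => θ x • θ.smulRight α
        map_add' := fun x y => by ext; simp [add_mul]
        map_smul' := fun a x => by ext; simp [mul_assoc] })) (by
      intro x y
      ext v
      simp
      ring)
  rw [← h, wedge]
  congr 1
  ext x v
  simp [wedge, ContinuousAlternatingMap.alternatizeUncurryFin_apply, Finset.mul_sum]

theorem wedge_wedge_swap (θ η : Cn n →L[ℝ] ℂ) (α : Cov n k) :
    wedge θ (wedge η α) = -wedge η (wedge θ α) := by
  have h := wedge_wedge_self (θ + η) α
  simp only [add_wedge, wedge_add, wedge_wedge_self, zero_add, add_zero] at h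
  exact eq_neg_of_add_eq_zero_right h

theorem alternatize_eq_sum_wedge (L : Cn n →L[ℝ] Cov n k) :
    ContinuousAlternatingMap.alternatizeUncurryFin L
      = ∑ i, wedge (dzCov i) (linPart L (stdVec i))
        + ∑ i, wedge (dzbarCov i) (antiPart L (stdVec i)) := by
  have h : L = ∑ i, (dzCov i).smulRight (linPart L (stdVec i))
      + ∑ i, (dzbarCov i).smulRight (antiPart L (stdVec i)) := by
    ext1 v
    conv_lhs => rw [apply_eq_sum L v]
    simp
  conv_lhs => rw [h]
  rw [ContinuousAlternatingMap.alternatizeUncurryFin_add]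
  congr 1 <;>
  · simp only [← ContinuousAlternatingMap.alternatizeUncurryFinCLM_apply, map_sum]
    rfl

theorem del_eq_sum (α : Cn n → Cov n k) (y : Cn n) :
    del α y = ∑ i, wedge (dzCov i) (dz i α y) := by
  rw [del, alternatize_eq_sum_wedge, linPart_linPart, antiPart_linPart]
  simp [dz]

theorem delbar_eq_sum (α : Cn n → Cov n k) (y : Cn n) :
    delbar α y = ∑ i, wedge (dzbarCov i) (dzbar i α y) := by
  rw [delbar, alternatize_eq_sum_wedge, linPart_antiPart, antiPart_antiPart]
  simp [dzbar]

theorem extDeriv_eq_sum (α : Cn n → Cov n k) (y : Cn n) :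
    extDeriv α y = ∑ i, wedge (dzCov i) (dz i α y) + ∑ i, wedge (dzbarCov i) (dzbar i α y) := by
  rw [extDeriv, alternatize_eq_sum_wedge]
  rfl

/-- The contraction with a vector is an antiderivation. -/
theorem curryLeft_wedge (θ : Cn n →L[ℝ] ℂ) (α : Cov n (k + 1)) (x : Cn n) :
    (wedge θ α).curryLeft x = θ x • α - wedge θ (α.curryLeft x) := by
  ext v
  have h (i : Fin (k + 1)) : Fin.removeNth i.succ (Matrix.vecCons x v)
      = Matrix.vecCons x (Fin.removeNth i v) := by
    ext j l
    refine Fin.cases ?_ (fun j => ?_) j <;> simp [Fin.removeNth, Matrix.vecCons]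
  have h0 : Fin.removeNth 0 (Matrix.vecCons x v) = v := by
    ext j l
    simp [Fin.removeNth, Matrix.vecCons]
  rw [ContinuousAlternatingMap.curryLeft_apply_apply, wedge_apply, Fin.sum_univ_succ]
  simp only [h, h0]
  have h1 : (θ x • α - wedge θ (α.curryLeft x)) v = θ x * α v
      - ∑ i : Fin (k + 1), (-1) ^ (i : ℕ) * (θ (v i) * α (Matrix.vecCons x (Fin.removeNth i v))) := by
    have h2 := wedge_apply θ (α.curryLeft x) v
    simp only [ContinuousAlternatingMap.curryLeft_apply_apply] at h2
    rw [← h2]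
    rfl
  rw [h1, sub_eq_add_neg, ← Finset.sum_neg_distrib]
  congr 1
  · simp
  · exact Finset.sum_congr rfl fun i _ => by simp [pow_succ]

end Wedge

/-! ### Top degree covectors and determinants -/

section TopDegree

variable {n k : ℕ}

theorem dZ_apply (v : Fin n → Cn n) : dZ n v = (Matrix.of v).det := rfl

theorem wedgeAll_apply (l : Fin n → (Cn n →L[ℝ] ℂ)) (v : Fin n → Cn n) :
    wedgeAll l v = (Matrix.of fun j i => l i (v j)).det := rfl

@[simp] theorem coeff_smul (a : ℂ) (α : Cov n n) : coeff (a • α) = a * coeff α := rfl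

@[simp] theorem coeff_dZ : coeff (dZ n) = 1 := by
  have h : Matrix.of (fun i => stdVec i : Fin n → Cn n) = 1 := by
    ext i j
    simp [stdVec_apply, Matrix.one_apply, eq_comm]
  rw [coeff, dZ_apply, h, Matrix.det_one]

theorem dZ_ne_zero : dZ n ≠ 0 := fun h => by
  have h1 : coeff (dZ n) = 1 := coeff_dZ
  rw [h] at h1
  exact zero_ne_one h1

/-- The wedge product with `θ` of a wedge product of `n` covectors is a determinant of size `n + 1`,
by expansion along the column of `θ`. -/
theorem wedge_wedgeAll_apply (θ : Cn n →L[ℝ] ℂ) (l : Fin n → (Cn n →L[ℝ] ℂ))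
    (v : Fin (n + 1) → Cn n) :
    wedge θ (wedgeAll l) v
      = (Matrix.of fun j i => (Fin.cons θ l : Fin (n + 1) → (Cn n →L[ℝ] ℂ)) i (v j)).det := by
  rw [wedge_apply, Matrix.det_succ_column_zero]
  refine Finset.sum_congr rfl fun i _ => ?_
  rw [wedgeAll_apply, mul_assoc]
  rfl

theorem wedge_wedgeAll_of_mem (l : Fin n → (Cn n →L[ℝ] ℂ)) (i : Fin n) :
    wedge (l i) (wedgeAll l) = 0 := by
  ext v
  rw [wedge_wedgeAll_apply]
  exact Matrix.det_zero_of_column_eq (Fin.succ_ne_zero i).symm fun j => by simp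

theorem wedgeAll_update_apply (l : Fin n → (Cn n →L[ℝ] ℂ)) (i : Fin n) (η : Cn n →L[ℝ] ℂ)
    (v : Fin n → Cn n) :
    wedgeAll (Function.update l i η) v
      = ((Matrix.of fun j i => l i (v j)).updateCol i fun j => η (v j)).det := by
  rw [wedgeAll_apply]
  congr 1
  ext j i'
  by_cases h : i' = i
  · subst h; simp
  · simp [h]

theorem wedgeAll_update_add (l : Fin n → (Cn n →L[ℝ] ℂ)) (i : Fin n) (η ξ : Cn n →L[ℝ] ℂ) :
    wedgeAll (Function.update l i (η + ξ))
      = wedgeAll (Function.update l i η) + wedgeAll (Function.update l i ξ) := by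
  ext v
  simp only [wedgeAll_update_apply, ContinuousAlternatingMap.add_apply,
    ← Matrix.det_updateCol_add]
  rfl

theorem wedgeAll_update_smul (l : Fin n → (Cn n →L[ℝ] ℂ)) (i : Fin n) (a : ℂ)
    (η : Cn n →L[ℝ] ℂ) :
    wedgeAll (Function.update l i (a • η)) = a • wedgeAll (Function.update l i η) := by
  ext v
  simp only [wedgeAll_update_apply, ContinuousAlternatingMap.smul_apply, smul_eq_mul,
    ← Matrix.det_updateCol_smul]
  rfl

theorem wedge_wedgeAll_update_self (l : Fin n → (Cn n →L[ℝ] ℂ)) (i : Fin n)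
    (η : Cn n →L[ℝ] ℂ) : wedge η (wedgeAll (Function.update l i η)) = 0 := by
  simpa using wedge_wedgeAll_of_mem (Function.update l i η) i

theorem wedge_wedgeAll_update_swap (l : Fin n → (Cn n →L[ℝ] ℂ)) (i : Fin n)
    (θ η : Cn n →L[ℝ] ℂ) :
    wedge θ (wedgeAll (Function.update l i η)) = -wedge η (wedgeAll (Function.update l i θ)) := by
  have h := wedge_wedgeAll_update_self l i (θ + η)
  simp only [add_wedge, wedgeAll_update_add, wedge_add, wedge_wedgeAll_update_self, zero_add,
    add_zero] at h
  exact eq_neg_of_add_eq_zero_right h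

/-! ### Covectors of type `(k,0)` -/

/-- Polarization of the homogeneity of a covector of type `(k,0)`: comparing both sides of
`α ((1 + iy) v) = (1 + iy)^k α v` as polynomials in the real variable `y` makes the identity
available for the complex value `y = -i`. -/
theorem IsOfType.two_pow_mul {α : Cov n k} (hα : IsOfType k 0 α) (v : Fin k → Cn n) :
    2 ^ k * α v
      = ∑ s : Finset (Fin k), (-Complex.I) ^ (sᶜ.card) * α (s.piecewise v (Complex.I • v)) := by
  let P : Polynomial ℂ := ∑ s : Finset (Fin k),
    Polynomial.X ^ (sᶜ.card) * Polynomial.C (α (s.piecewise v (Complex.I • v)))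
  let Q : Polynomial ℂ := (1 + Polynomial.C Complex.I * Polynomial.X) ^ k * Polynomial.C (α v)
  have hPQ : P = Q := by
    refine Polynomial.eq_of_infinite_eval_eq P Q
      ((Set.infinite_range_of_injective Complex.ofReal_injective).mono ?_)
    rintro _ ⟨y, rfl⟩
    have h1 : α (fun j => (1 + Complex.I * y) • v j) = (1 + Complex.I * y) ^ k * α v := by
      simpa using hα.2 (1 + Complex.I * y) v
    have h2 : (fun j => (1 + Complex.I * y) • v j) = v + fun j => y • (Complex.I • v j) := by
      ext j l
      simp
      ring
    have h3 (s : Finset (Fin k)) : s.piecewise v (fun j => y • (Complex.I • v j))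
        = sᶜ.piecewise (fun j => y • (s.piecewise v (Complex.I • v)) j)
            (s.piecewise v (Complex.I • v)) := by
      ext j l
      by_cases hj : j ∈ s <;> simp [hj]
    rw [h2, ContinuousAlternatingMap.map_add_univ] at h1
    simp only [Set.mem_ofPred_eq, P, Q, Polynomial.eval_finsetSum, Polynomial.eval_mul,
      Polynomial.eval_pow, Polynomial.eval_X, Polynomial.eval_C, Polynomial.eval_add,
      Polynomial.eval_one]
    rw [← h1]
    refine Finset.sum_congr rfl fun s _ => ?_
    rw [h3 s, ContinuousAlternatingMap.map_piecewise_smul (c := fun _ => y)]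
    simp
  have h := congrArg (Polynomial.eval (-Complex.I)) hPQ
  simp only [P, Q, Polynomial.eval_finsetSum, Polynomial.eval_mul,
      Polynomial.eval_pow, Polynomial.eval_X, Polynomial.eval_C, Polynomial.eval_add,
      Polynomial.eval_one, mul_neg, Complex.I_mul_I, neg_neg] at h
  rw [h]
  norm_num

theorem IsOfType.map_update_I_smul {α : Cov n k} (hα : IsOfType k 0 α) (v : Fin k → Cn n)
    (i : Fin k) : α (Function.update v i (Complex.I • v i)) = Complex.I * α v := by
  have h2 : (2 : ℂ) ^ k ≠ 0 := by positivity
  apply mul_left_cancel₀ h2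
  rw [mul_left_comm, hα.two_pow_mul, hα.two_pow_mul, Finset.mul_sum]
  -- adding or removing the index `i` exchanges the terms of the two sums
  let e : Finset (Fin k) ≃ Finset (Fin k) :=
    ⟨fun s => symmDiff s {i}, fun s => symmDiff s {i},
      fun s => symmDiff_symmDiff_cancel_right {i} s, fun s => symmDiff_symmDiff_cancel_right {i} s⟩
  refine Fintype.sum_equiv e _ _ fun s => ?_
  have key (t : Finset (Fin k)) (ht : i ∉ t) :
      (insert i t).piecewise (Function.update v i (Complex.I • v i))
          (Complex.I • Function.update v i (Complex.I • v i))
        = t.piecewise v (Complex.I • v) ∧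
      t.piecewise (Function.update v i (Complex.I • v i))
          (Complex.I • Function.update v i (Complex.I • v i))
        = Function.update ((insert i t).piecewise v (Complex.I • v)) i
            ((-1 : ℝ) • ((insert i t).piecewise v (Complex.I • v)) i) ∧
      tᶜ.card = (insert i t)ᶜ.card + 1 := by
    refine ⟨?_, ?_, ?_⟩
    · funext j
      by_cases hj : j = i
      · subst hj; simp [ht]
      · by_cases hjt : j ∈ t <;> simp [hj, hjt]
    · funext j
      by_cases hj : j = i
      · subst hj; simp [ht, smul_smul]
      · by_cases hjt : j ∈ t <;> simp [hj, hjt]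
    · have h : tᶜ = insert i (insert i t)ᶜ := by
        ext j
        by_cases hj : j = i
        · subst hj; simp [ht]
        · simp [hj]
      rw [h, Finset.card_insert_of_notMem (by simp)]
  by_cases hi : i ∈ s
  · have hs : e s = s.erase i := by
      ext j
      by_cases hj : j = i
      · subst hj; simp [e, Finset.mem_symmDiff, hi]
      · simp [e, Finset.mem_symmDiff, hj]
    obtain ⟨h1, -, h3⟩ := key (s.erase i) (Finset.notMem_erase i s)
    rw [Finset.insert_erase hi] at h1 h3
    rw [hs, h1, h3, pow_succ]
    linear_combination (-Complex.I) ^ sᶜ.card *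
      α ((s.erase i).piecewise v (Complex.I • v)) * Complex.I_mul_I
  · have hs : e s = insert i s := by
      ext j
      by_cases hj : j = i
      · subst hj; simp [e, Finset.mem_symmDiff, hi]
      · simp [e, Finset.mem_symmDiff, hj]
    obtain ⟨-, h2, h3⟩ := key s hi
    rw [hs, h2, h3, ContinuousAlternatingMap.map_update_smul, Function.update_eq_self, pow_succ]
    simp
    ring

theorem IsOfType.map_update_smul {α : Cov n k} (hα : IsOfType k 0 α) (v : Fin k → Cn n)
    (i : Fin k) (a : ℂ) (x : Cn n) :
    α (Function.update v i (a • x)) = a * α (Function.update v i x) := by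
  have hI := hα.map_update_I_smul (Function.update v i x) i
  rw [Function.update_idem, Function.update_self] at hI
  have h : a • x = a.re • x + a.im • (Complex.I • x) := by
    rw [← Complex.coe_smul, ← Complex.coe_smul, smul_smul, ← add_smul, Complex.re_add_im]
  rw [h, ContinuousAlternatingMap.map_update_add, ContinuousAlternatingMap.map_update_smul,
    ContinuousAlternatingMap.map_update_smul, hI]
  conv_rhs => rw [← Complex.re_add_im a]
  simp only [Complex.real_smul]
  ring

/-- A covector of type `(n,0)` is complex multilinear, hence a multiple of the determinant. -/
theorem IsOfType.eq_coeff_smul_dZ {α : Cov n n} (hα : IsOfType n 0 α) :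
    α = coeff α • dZ n := by
  let A : (Cn n) [⋀^Fin n]→ₗ[ℂ] ℂ :=
    { toFun := α
      map_update_add' := fun {inst} v i x y => by
        obtain rfl := Subsingleton.elim inst (instDecidableEqFin n)
        exact α.map_update_add v i x y
      map_update_smul' := fun {inst} v i a x => by
        obtain rfl := Subsingleton.elim inst (instDecidableEqFin n)
        exact hα.map_update_smul v i a x
      map_eq_zero_of_eq' := fun v i j h hij => α.map_eq_zero_of_eq v h hij }
  have h : A = coeff α • (Matrix.detRowAlternating : (Cn n) [⋀^Fin n]→ₗ[ℂ] ℂ) := by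
    have h := A.eq_smul_basis_det (Pi.basisFun ℂ (Fin n))
    rw [Pi.basisFun_det] at h
    rw [h]
    congr 1
    change α _ = α _
    congr 1
    ext i j
    simp [stdVec]
  ext v
  exact congrArg (fun B : (Cn n) [⋀^Fin n]→ₗ[ℂ] ℂ => B v) h

/-! ### Contractions -/

theorem contract_wedge (i : Fin n) (θ : Cn n →L[ℝ] ℂ) (α : Cov n (k + 1)) :
    contract i (wedge θ α) = linPart θ (stdVec i) • α - wedge θ (contract i α) := by
  simp only [contract, linPart_apply, curryLeft_wedge, wedge_smul, sub_eq_add_neg, wedge_add,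
    wedge_neg]
  module

theorem antiPart_curryLeft_wedge (i : Fin n) (θ : Cn n →L[ℝ] ℂ) (α : Cov n (k + 1)) :
    antiPart (wedge θ α).curryLeft (stdVec i)
      = antiPart θ (stdVec i) • α - wedge θ (antiPart α.curryLeft (stdVec i)) := by
  simp only [antiPart_apply, curryLeft_wedge, wedge_smul, sub_eq_add_neg, wedge_add]
  module

/-- The coframe `e^i = dz^i + φ^i`. -/
def coframe (Φ : Matrix (Fin n) (Fin n) ℂ) (i : Fin n) : Cn n →L[ℝ] ℂ := dzCov i + comp01 Φ i

theorem frame_eq_wedgeAll (Φ : Matrix (Fin n) (Fin n) ℂ) : frame Φ = wedgeAll (coframe Φ) := rfl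

theorem frame_zero : frame (0 : Matrix (Fin n) (Fin n) ℂ) = dZ n := by
  ext v
  rw [frame, wedgeAll_apply, dZ_apply]
  congr 1
  ext j i
  simp [comp01]

/-- The vectors `∂̄_j - φ(∂̄_j)` annihilate the coframe `e^i`, hence also `e^1 ∧ ⋯ ∧ e^n`. -/
theorem curryLeft_frame {k : ℕ} (Φ : Matrix (Fin (k + 1)) (Fin (k + 1)) ℂ) (j : Fin (k + 1)) :
    antiPart (frame Φ).curryLeft (stdVec j)
      = ∑ i, Φ i j • linPart (frame Φ).curryLeft (stdVec i) := by
  ext u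
  -- expanding the determinant, the contraction is a combination of the `e^i`
  let C : Fin (k + 1) → ℂ := fun i =>
    (-1) ^ (i : ℕ) * ((Matrix.of fun a b => coframe Φ b (u a)).submatrix id i.succAbove).det
  have hC (x : Cn (k + 1)) : (frame Φ).curryLeft x u = ∑ i, C i * coframe Φ i x := by
    rw [ContinuousAlternatingMap.curryLeft_apply_apply, frame_eq_wedgeAll, wedgeAll_apply,
      Matrix.det_succ_row_zero]
    refine Finset.sum_congr rfl fun i _ => ?_
    simp only [C, Matrix.of_apply, Matrix.cons_val_zero]
    rw [mul_right_comm]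
    rfl
  have h1 (x : Cn (k + 1)) : antiPart (frame Φ).curryLeft x u
      = ∑ i, C i * antiPart (coframe Φ i) x := by
    change (1 / 2 : ℂ) * ((frame Φ).curryLeft x u
      + Complex.I * (frame Φ).curryLeft (Complex.I • x) u) = _
    simp only [hC, antiPart_apply, Finset.mul_sum, ← Finset.sum_add_distrib, smul_eq_mul]
    exact Finset.sum_congr rfl fun i _ => by ring
  have h2 (x : Cn (k + 1)) : linPart (frame Φ).curryLeft x u
      = ∑ i, C i * linPart (coframe Φ i) x := by
    change (1 / 2 : ℂ) * ((frame Φ).curryLeft x u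
      - Complex.I * (frame Φ).curryLeft (Complex.I • x) u) = _
    simp only [hC, linPart_apply, Finset.mul_sum, ← Finset.sum_sub_distrib, smul_eq_mul]
    exact Finset.sum_congr rfl fun i _ => by ring
  rw [h1, ContinuousAlternatingMap.sum_apply]
  simp only [ContinuousAlternatingMap.smul_apply, h2]
  simp [coframe, mul_comm]

/-- The covectors `dz̄^j ∧ e^1 ∧ ⋯ ∧ e^n` are linearly independent. -/
theorem eq_zero_of_sum_smul_wedge_frame {Φ : Matrix (Fin n) (Fin n) ℂ} (hF : frame Φ ≠ 0)
    (a : Fin n → ℂ) (h : ∑ j, a j • wedge (dzbarCov j) (frame Φ) = 0) (j : Fin n) : a j = 0 := by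
  obtain _ | k := n
  · exact j.elim0
  have h' : wedge (∑ j, a j • dzbarCov j) (frame Φ) = 0 := by
    rw [sum_wedge, ← h]
    simp only [smul_wedge]
  have h0 : (0 : Cov (k + 1) (k + 1 + 1)).curryLeft = 0 := by ext; simp
  have h1 := antiPart_curryLeft_wedge j (∑ j, a j • dzbarCov j) (frame Φ)
  have h2 (i : Fin (k + 1)) := contract_wedge i (∑ j, a j • dzbarCov j) (frame Φ)
  simp only [contract, h', h0, antiPart_zero, linPart_zero, _root_.zero_apply] at h1 h2
  rw [curryLeft_frame, wedge_sum] at h1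
  simp only [wedge_smul] at h1
  have h3 (i : Fin (k + 1)) :
      wedge (∑ j, a j • dzbarCov j) (linPart (frame Φ).curryLeft (stdVec i)) = 0 := by
    simpa [eq_comm] using h2 i
  have h4 : 0 = a j • frame Φ := by simpa [h3] using h1
  exact eq_zero_of_cov_smul_eq_zero h4.symm hF

end TopDegree

/-! ### Wirtinger derivatives -/

section Wirtinger

variable {n : ℕ} {F : Type*} [NormedAddCommGroup F] [NormedSpace ℝ F] [NormedSpace ℂ F]
  [IsScalarTower ℝ ℂ F] {y : Cn n}

theorem dz_congr {f g : Cn n → F} (h : f =ᶠ[nhds y] g) (i : Fin n) : dz i f y = dz i g y := by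
  rw [dz, dz, h.fderiv_eq]

theorem dzbar_congr {f g : Cn n → F} (h : f =ᶠ[nhds y] g) (i : Fin n) :
    dzbar i f y = dzbar i g y := by
  rw [dzbar, dzbar, h.fderiv_eq]

theorem dz_sum {ι : Type*} {s : Finset ι} {f : ι → Cn n → F}
    (hf : ∀ p ∈ s, DifferentiableAt ℝ (f p) y) (i : Fin n) :
    dz i (fun x => ∑ p ∈ s, f p x) y = ∑ p ∈ s, dz i (f p) y := by
  simp only [dz, fderiv_fun_sum hf, linPart_sum, _root_.sum_apply]

theorem dzbar_sum {ι : Type*} {s : Finset ι} {f : ι → Cn n → F}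
    (hf : ∀ p ∈ s, DifferentiableAt ℝ (f p) y) (i : Fin n) :
    dzbar i (fun x => ∑ p ∈ s, f p x) y = ∑ p ∈ s, dzbar i (f p) y := by
  simp only [dzbar, fderiv_fun_sum hf, antiPart_sum, _root_.sum_apply]

theorem dz_mul {f g : Cn n → ℂ} (hf : DifferentiableAt ℝ f y) (hg : DifferentiableAt ℝ g y)
    (i : Fin n) : dz i (fun x => f x * g x) y = f y * dz i g y + g y * dz i f y := by
  simp [dz, fderiv_fun_mul hf hg]

theorem fderiv_smul_const' {f : Cn n → ℂ} (hf : DifferentiableAt ℝ f y) (A : F) :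
    fderiv ℝ (fun x => f x • A) y = (fderiv ℝ f y).smulRight A :=
  (hf.hasFDerivAt.smul_const A).fderiv

theorem dz_smul_const {f : Cn n → ℂ} (hf : DifferentiableAt ℝ f y) (A : F) (i : Fin n) :
    dz i (fun x => f x • A) y = dz i f y • A := by
  rw [dz, fderiv_smul_const' hf, linPart_smulRight, dz]

theorem dzbar_smul_const {f : Cn n → ℂ} (hf : DifferentiableAt ℝ f y) (A : F) (i : Fin n) :
    dzbar i (fun x => f x • A) y = dzbar i f y • A := by
  rw [dzbar, fderiv_smul_const' hf, antiPart_smulRight, dzbar]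

end Wirtinger

/-! ### The derivative of a determinant -/

section Jacobi

variable {n : ℕ} {E : Type*} [NormedAddCommGroup E] [NormedSpace ℝ E]

/-- Jacobi's formula. -/
theorem hasFDerivAt_det {A : E → Matrix (Fin n) (Fin n) ℂ} {y : E}
    (hA : ∀ i j, DifferentiableAt ℝ (fun x => A x i j) y) :
    HasFDerivAt (fun x => (A x).det)
      (∑ i, ∑ j, (A y).adjugate i j • fderiv ℝ (fun x => A x j i) y) y := by
  have hA' : HasFDerivAt (fun x => (fun i j => A x i j : Fin n → Cn n))
      (ContinuousLinearMap.pi fun i => ContinuousLinearMap.pi fun j =>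
        fderiv ℝ (fun x => A x i j) y) y := by
    rw [hasFDerivAt_pi]
    intro i
    rw [hasFDerivAt_pi]
    exact fun j => (hA i j).hasFDerivAt
  have h := ((dZ n).toContinuousMultilinearMap.hasFDerivAt (fun i j => A y i j)).comp y hA'
  refine h.congr_fderiv ?_
  ext x
  rw [ContinuousLinearMap.comp_apply, ContinuousMultilinearMap.linearDeriv_apply]
  simp only [_root_.sum_apply, _root_.smul_apply, smul_eq_mul]
  rw [Finset.sum_comm]
  refine Finset.sum_congr rfl fun i _ => ?_
  have h1 := congrFun (Matrix.cramer_eq_adjugate_mulVec (A y)ᵀ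
    fun j => fderiv ℝ (fun x => A x i j) y x) i
  rw [Matrix.cramer_transpose_apply, ← Matrix.adjugate_transpose] at h1
  rw [Matrix.mulVec, dotProduct] at h1
  exact h1

theorem differentiableAt_det {A : E → Matrix (Fin n) (Fin n) ℂ} {y : E}
    (hA : ∀ i j, DifferentiableAt ℝ (fun x => A x i j) y) :
    DifferentiableAt ℝ (fun x => (A x).det) y := (hasFDerivAt_det hA).differentiableAt

variable {A : Cn n → Matrix (Fin n) (Fin n) ℂ} {y : Cn n}

theorem dz_det (hA : ∀ i j, DifferentiableAt ℝ (fun x => A x i j) y) (k : Fin n) :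
    dz k (fun x => (A x).det) y
      = ∑ i, ∑ j, (A y).adjugate i j * dz k (fun x => A x j i) y := by
  simp [dz, (hasFDerivAt_det hA).fderiv]

theorem dzbar_det (hA : ∀ i j, DifferentiableAt ℝ (fun x => A x i j) y) (k : Fin n) :
    dzbar k (fun x => (A x).det) y
      = ∑ i, ∑ j, (A y).adjugate i j * dzbar k (fun x => A x j i) y := by
  simp [dzbar, (hasFDerivAt_det hA).fderiv]

end Jacobi

/-! ### The divergence and the connection in coordinates -/

section Coordinates

variable {n k : ℕ}

theorem toCov_apply (θ : Cn n →L[ℝ] ℂ) (v : Fin 1 → Cn n) : toCov θ v = θ (v 0) := rfl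

theorem ofCov_toCov (θ : Cn n →L[ℝ] ℂ) : ofCov (toCov θ) = θ :=
  (ContinuousAlternatingMap.ofSubsingleton ℝ (Cn n) ℂ (0 : Fin 1)).symm_apply_apply θ

theorem toCov_smul (a : ℂ) (θ : Cn n →L[ℝ] ℂ) : toCov (a • θ) = a • toCov θ := rfl

theorem toCov_sum {ι : Type*} (s : Finset ι) (θ : ι → Cn n →L[ℝ] ℂ) :
    toCov (∑ p ∈ s, θ p) = ∑ p ∈ s, toCov (θ p) := by
  ext v
  simp [toCov_apply]

theorem toCov_comp01 (Φ : Matrix (Fin n) (Fin n) ℂ) (i : Fin n) :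
    toCov (comp01 Φ i) = ∑ j, Φ i j • toCov (dzbarCov j) := by
  simp only [comp01, toCov_sum, toCov_smul]

theorem curryLeft_smul (a : ℂ) (α : Cov n (k + 1)) :
    (a • α).curryLeft = a • α.curryLeft := rfl

theorem contract_add (i : Fin n) (α β : Cov n (k + 1)) :
    contract i (α + β) = contract i α + contract i β := by
  simp [contract]

theorem contract_smul (i : Fin n) (a : ℂ) (α : Cov n (k + 1)) :
    contract i (a • α) = a • contract i α := by
  simp [contract, curryLeft_smul]

theorem contract_zero (i : Fin n) : contract i (0 : Cov n (k + 1)) = 0 := by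
  simpa using contract_smul i 0 (0 : Cov n (k + 1))

theorem contract_sum {ι : Type*} (s : Finset ι) (i : Fin n) (α : ι → Cov n (k + 1)) :
    contract i (∑ p ∈ s, α p) = ∑ p ∈ s, contract i (α p) := by
  classical
  induction s using Finset.induction_on with
  | empty => simp [contract_zero]
  | insert a s ha ih => simp [Finset.sum_insert ha, ih, contract_add]

/-- `∂_i ⌟ (θ ∧ η) = θ(∂_i) η - η(∂_i) θ` for `1`-covectors. -/
theorem contract_wedge_toCov (i : Fin n) (θ η : Cn n →L[ℝ] ℂ) :
    contract i (wedge θ (toCov η))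
      = linPart θ (stdVec i) • toCov η - linPart η (stdVec i) • toCov θ := by
  rw [contract_wedge]
  congr 1
  ext v
  have h (w : Fin 0 → Cn n) : contract i (toCov η) w = linPart η (stdVec i) := rfl
  simp only [wedge_apply, h]
  simp [toCov_apply, mul_comm]

theorem wedge_dzCov_dZ (i : Fin n) : wedge (dzCov i) (dZ n) = 0 :=
  wedge_wedgeAll_of_mem dzCov i

theorem wedge_dzCov_contract_dZ {k : ℕ} (a i : Fin (k + 1)) :
    wedge (dzCov a) (contract i (dZ (k + 1))) = if a = i then dZ (k + 1) else 0 := by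
  have h := contract_wedge i (dzCov a) (dZ (k + 1))
  rw [wedge_dzCov_dZ, contract_zero, eq_comm, sub_eq_zero, linPart_dzCov] at h
  rw [← h]
  split_ifs <;> simp

theorem wedge_dzCov_wedge_contract_dZ {k : ℕ} (a i : Fin (k + 1)) (η : Cn (k + 1) →L[ℝ] ℂ) :
    wedge (dzCov a) (wedge η (contract i (dZ (k + 1))))
      = if a = i then -wedge η (dZ (k + 1)) else 0 := by
  rw [wedge_wedge_swap, wedge_dzCov_contract_dZ]
  split_ifs <;> simp

theorem contraction_smul_dZ {k : ℕ} (Φ : Matrix (Fin (k + 1)) (Fin (k + 1)) ℂ) (a : ℂ) :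
    contraction Φ (a • dZ (k + 1))
      = ∑ i, ∑ j, (a * Φ i j) • wedge (dzbarCov j) (contract i (dZ (k + 1))) := by
  simp only [contraction, contract_smul, wedge_smul, comp01, sum_wedge, smul_wedge,
    Finset.smul_sum, smul_smul]

/-- `∂(φ ⌟ (f dz^1 ∧ ⋯ ∧ dz^n)) = -∑ ∂_i(f φ^i_{j̄}) dz̄^j ∧ dz^1 ∧ ⋯ ∧ dz^n`. -/
theorem del_contraction {k : ℕ} {Φ : Cn (k + 1) → Matrix (Fin (k + 1)) (Fin (k + 1)) ℂ}
    {f : Cn (k + 1) → ℂ} {y : Cn (k + 1)} (hf : DifferentiableAt ℝ f y)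
    (hΦ : ∀ i j, DifferentiableAt ℝ (fun x => Φ x i j) y) :
    del (fun x => contraction (Φ x) (f x • dZ (k + 1))) y
      = ∑ j, (-∑ i, dz i (fun x => f x * Φ x i j) y) • wedge (dzbarCov j) (dZ (k + 1)) := by
  have hfΦ (i j) : DifferentiableAt ℝ (fun x => f x * Φ x i j) y := hf.mul (hΦ i j)
  have h (a : Fin (k + 1)) : dz a (fun x => contraction (Φ x) (f x • dZ (k + 1))) y
      = ∑ i, ∑ j, dz a (fun x => f x * Φ x i j) y •
          wedge (dzbarCov j) (contract i (dZ (k + 1))) := by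
    simp only [contraction_smul_dZ]
    rw [dz_sum fun i _ => DifferentiableAt.fun_sum fun j _ => (hfΦ i j).smul_const _]
    refine Finset.sum_congr rfl fun i _ => ?_
    rw [dz_sum fun j _ => (hfΦ i j).smul_const _]
    exact Finset.sum_congr rfl fun j _ => dz_smul_const (hfΦ i j) _ _
  rw [del_eq_sum]
  have h' (a : Fin (k + 1)) :
      wedge (dzCov a) (dz a (fun x => contraction (Φ x) (f x • dZ (k + 1))) y)
        = ∑ j, dz a (fun x => f x * Φ x a j) y • -wedge (dzbarCov j) (dZ (k + 1)) := by
    simp only [h, wedge_sum, wedge_smul, wedge_dzCov_wedge_contract_dZ]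
    rw [Finset.sum_eq_single a (fun i _ hi => by simp [hi.symm]) (by simp)]
    simp
  simp only [h']
  rw [Finset.sum_comm]
  refine Finset.sum_congr rfl fun j _ => ?_
  rw [← Finset.sum_smul, smul_neg]
  exact (neg_smul _ _).symm

section Divergence

variable {M : Type*} [TopologicalSpace M] [ChartedSpace (Cn n) M]

theorem VectorForm.differentiableAt (φ : VectorForm n M) {c : OpenPartialHomeomorph M (Cn n)}
    (hc : c ∈ holCharts n M) {y : Cn n} (hy : y ∈ c.target) (i j : Fin n) :
    DifferentiableAt ℝ (fun x => φ.rep c x i j) y :=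
  ((φ.smooth c hc i j).contDiffAt (c.open_target.mem_nhds hy)).differentiableAt (by simp)

theorem KahlerMetric.differentiableAt (g : KahlerMetric n M)
    {c : OpenPartialHomeomorph M (Cn n)} (hc : c ∈ holCharts n M) {y : Cn n} (hy : y ∈ c.target)
    (i j : Fin n) : DifferentiableAt ℝ (fun x => g.rep c x i j) y :=
  ((g.smooth c hc i j).contDiffAt (c.open_target.mem_nhds hy)).differentiableAt (by simp)

theorem KahlerMetric.det_ne_zero (g : KahlerMetric n M)
    {c : OpenPartialHomeomorph M (Cn n)} (hc : c ∈ holCharts n M) {y : Cn n}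
    (hy : y ∈ c.target) : (g.rep c y).det ≠ 0 :=
  (g.posDef c hc y hy).det_pos.ne'

/-- The trace `∑_p θ_i^p(∂_p)` of the connection is `∂_i log det g`: by the Kähler condition it
equals `tr (g⁻¹ ∂_i g)`. -/
theorem KahlerMetric.sum_connForm (g : KahlerMetric n M)
    {c : OpenPartialHomeomorph M (Cn n)} (hc : c ∈ holCharts n M) {y : Cn n}
    (hy : y ∈ c.target) (i : Fin n) :
    ∑ p, linPart (g.connForm c i p y) (stdVec p)
      = (g.rep c y).det⁻¹ * dz i (fun x => (g.rep c x).det) y := by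
  rw [dz_det (g.differentiableAt hc hy), Finset.mul_sum]
  simp only [KahlerMetric.connForm, linPart_sum, linPart_smul, linPart_linPart,
    _root_.sum_apply, _root_.smul_apply, smul_eq_mul, Finset.mul_sum]
  rw [Finset.sum_comm]
  refine Finset.sum_congr rfl fun l _ => Finset.sum_congr rfl fun p _ => ?_
  have h := g.kahler c hc y hy i p l
  rw [dz] at h
  rw [Matrix.inv_def, Ring.inverse_eq_inv']
  rw [Matrix.smul_apply, smul_eq_mul, mul_assoc, h]

theorem divergence_eq (g : KahlerMetric n M) (φ : VectorForm n M)
    {c : OpenPartialHomeomorph M (Cn n)} (hc : c ∈ holCharts n M) {y : Cn n}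
    (hy : y ∈ c.target) :
    divergence g φ c y = ∑ j, (∑ i, dz i (fun x => φ.rep c x i j) y
      + ∑ i, φ.rep c y i j * ((g.rep c y).det⁻¹ * dz i (fun x => (g.rep c x).det) y))
        • dzbarCov j := by
  have hφ := φ.differentiableAt hc hy
  have h1 (p a : Fin n) : dz a (fun x => toCov (comp01 (φ.rep c x) p)) y
      = ∑ j, dz a (fun x => φ.rep c x p j) y • toCov (dzbarCov j) := by
    simp only [toCov_comp01]
    rw [dz_sum fun j _ => (hφ p j).smul_const _]
    exact Finset.sum_congr rfl fun j _ => dz_smul_const (hφ p j) _ _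
  have h2 (p : Fin n) : contract p (del (fun x => toCov (comp01 (φ.rep c x) p)) y)
      = ∑ j, dz p (fun x => φ.rep c x p j) y • toCov (dzbarCov j) := by
    rw [del_eq_sum]
    simp only [h1, wedge_sum, wedge_smul, contract_sum, contract_smul, contract_wedge_toCov,
      linPart_dzCov, linPart_dzbarCov, cov_zero_smul, sub_zero]
    rw [Finset.sum_eq_single p (fun i _ hi => by simp [hi]) (by simp)]
    simp
  have h3 (p : Fin n) : contract p (dPrime g φ c p y)
      = ∑ j, dz p (fun x => φ.rep c x p j) y • toCov (dzbarCov j)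
        + ∑ i, linPart (g.connForm c i p y) (stdVec p) • toCov (comp01 (φ.rep c y) i) := by
    have h : dPrime g φ c p y = del (fun x => toCov (comp01 (φ.rep c x) p)) y
        + (-1 : ℂ) • ∑ i, wedge (comp01 (φ.rep c y) i) (toCov (g.connForm c i p y)) := by
      rw [dPrime]
      module
    rw [h, contract_add, contract_smul, contract_sum, h2]
    simp only [contract_wedge_toCov, linPart_comp01, cov_zero_smul, zero_sub,
      Finset.sum_neg_distrib, smul_neg, neg_smul, one_smul, neg_neg]
  have h4 : ∑ p, contract p (dPrime g φ c p y)
      = toCov (∑ j, (∑ i, dz i (fun x => φ.rep c x i j) y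
      + ∑ i, φ.rep c y i j * ((g.rep c y).det⁻¹ * dz i (fun x => (g.rep c x).det) y))
        • dzbarCov j) := by
    simp only [h3, Finset.sum_add_distrib, toCov_sum, toCov_smul, cov_add_smul, cov_sum_smul]
    congr 1
    · rw [Finset.sum_comm]
    · rw [Finset.sum_comm]
      have h (i : Fin n) :
          ∑ p, linPart (g.connForm c i p y) (stdVec p) • toCov (comp01 (φ.rep c y) i)
            = ∑ j, (φ.rep c y i j * ((g.rep c y).det⁻¹ * dz i (fun x => (g.rep c x).det) y))
              • toCov (dzbarCov j) := by
        rw [← cov_sum_smul, g.sum_connForm hc hy, toCov_comp01, Finset.smul_sum]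
        simp only [smul_smul, mul_comm]
      simp only [h]
      rw [Finset.sum_comm]
  rw [divergence, h4, ofCov_toCov]

/-- The connection form `h⁻¹ ∂h` of `(K_M^{⊗ r}, h)` is `-r ∂ log det g`. -/
theorem bundleMetric_connection (g : KahlerMetric n M) (r : ℕ)
    {c : OpenPartialHomeomorph M (Cn n)} (hc : c ∈ holCharts n M) {y : Cn n}
    (hy : y ∈ c.target) :
    (bundleMetric g r c y)⁻¹ • linPart (fderiv ℝ (bundleMetric g r c) y)
      = ∑ i, (-(r : ℂ) * ((g.rep c y).det⁻¹ * dz i (fun x => (g.rep c x).det) y)) • dzCov i := by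
  have hd := differentiableAt_det (g.differentiableAt hc hy)
  have h0 := g.det_ne_zero hc hy
  have hder : fderiv ℝ (bundleMetric g r c) y
      = (bundleMetric g r c y * (-(r : ℂ) * (g.rep c y).det⁻¹)) •
          fderiv ℝ (fun x => (g.rep c x).det) y := by
    have h1 := (hasDerivAt_inv (pow_ne_zero r h0)).comp ((g.rep c y).det)
      (hasDerivAt_pow r (g.rep c y).det)
    have h2 := h1.comp_hasFDerivAt_of_eq y hd.hasFDerivAt rfl
    refine h2.fderiv.trans ?_
    congr 1
    rw [bundleMetric]
    cases r with
    | zero => simp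
    | succ r =>
      field_simp
      simp
      ring
  rw [hder, linPart_smul, smul_smul]
  have hb : bundleMetric g r c y ≠ 0 := inv_ne_zero (pow_ne_zero r h0)
  rw [inv_mul_cancel_left₀ hb]
  conv_lhs => rw [eq_sum_dzCov (linPart (fderiv ℝ (fun x => (g.rep c x).det) y))]
  ext v
  simp [linPart_linPart, antiPart_linPart, Finset.mul_sum, mul_assoc, dz]

/-! ### The extension equation in coordinates -/

theorem TwistedForm.differentiableAt_coeff {r : ℕ} (σ : TwistedForm n M r n)
    {c : OpenPartialHomeomorph M (Cn n)}
    (hc : c ∈ holCharts n M) {y : Cn n} (hy : y ∈ c.target) :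
    DifferentiableAt ℝ (fun x => coeff (σ.rep c x)) y :=
  (ContinuousAlternatingMap.apply ℝ (Cn n) ℂ (fun i => stdVec i)).differentiableAt.comp y
    (((σ.smooth c hc).contDiffAt (c.open_target.mem_nhds hy)).differentiableAt (by simp))

theorem TwistedForm.rep_eq {r : ℕ} {σ : TwistedForm n M r n} (hσ : σ.HasType n 0)
    {c : OpenPartialHomeomorph M (Cn n)} (hc : c ∈ holCharts n M) {y : Cn n}
    (hy : y ∈ c.target) : σ.rep c y = coeff (σ.rep c y) • dZ n :=
  (hσ c hc y hy).eq_coeff_smul_dZ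

/-- The terms in `∂_i log det g` of `∇'` and of `div φ` cancel, and comparing the coefficients of
`dz̄^j ∧ dz^1 ∧ ⋯ ∧ dz^n` leaves the local equation. -/
theorem extensionEqOn_iff_localEqOn (g : KahlerMetric n M) (φ : VectorForm n M) {m : ℕ}
    (hm : 1 ≤ m) {σ : TwistedForm n M (m - 1) n} (hσ : σ.HasType n 0)
    {c : OpenPartialHomeomorph M (Cn n)} (hc : c ∈ holCharts n M) :
    ExtensionEqOn g φ m σ c ↔ LocalEqOn φ m σ c := by
  refine forall₂_congr fun y hy => ?_
  obtain _ | k := n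
  -- in dimension `0` every form of degree `1` vanishes
  · refine iff_of_true ?_ fun j => j.elim0
    ext v
    have hv : v 0 = 0 := Subsingleton.elim _ _
    rw [ContinuousAlternatingMap.map_coord_zero _ 0 hv,
      ContinuousAlternatingMap.map_coord_zero _ 0 hv]
  set f : Cn (k + 1) → ℂ := fun x => coeff (σ.rep c x) with hf_def
  have hf : DifferentiableAt ℝ f y := σ.differentiableAt_coeff hc hy
  have hφ := φ.differentiableAt hc hy
  have hσf : σ.rep c =ᶠ[nhds y] fun x => f x • dZ (k + 1) :=
    Filter.eventually_of_mem (c.open_target.mem_nhds hy) fun x hx => TwistedForm.rep_eq hσ hc hx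
  set W : Fin (k + 1) → Cov (k + 1) (k + 1 + 1) := fun j => wedge (dzbarCov j) (dZ (k + 1))
    with hW
  -- `∂_i log det g`
  set G : Fin (k + 1) → ℂ := fun i =>
    (g.rep c y).det⁻¹ * dz i (fun x => (g.rep c x).det) y with hG
  have h1 : delbar (σ.rep c) y = ∑ j, dzbar j f y • W j := by
    rw [delbar_eq_sum]
    refine Finset.sum_congr rfl fun j _ => ?_
    rw [dzbar_congr hσf, dzbar_smul_const hf, wedge_smul]
  have h2 : del (fun x => contraction (φ.rep c x) (σ.rep c x)) y
      = ∑ j, (-∑ i, dz i (fun x => f x * φ.rep c x i j) y) • W j := by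
    rw [← del_contraction hf hφ, del, del, Filter.EventuallyEq.fderiv_eq]
    filter_upwards [hσf] with x hx
    rw [hx]
  have h3 : wedge ((bundleMetric g (m - 1) c y)⁻¹ •
        linPart (fderiv ℝ (bundleMetric g (m - 1) c) y)) (contraction (φ.rep c y) (σ.rep c y))
      = ∑ j, (((m : ℂ) - 1) * ∑ i, G i * (f y * φ.rep c y i j)) • W j := by
    rw [hσf.eq_of_nhds, bundleMetric_connection g _ hc hy, contraction_smul_dZ, sum_wedge]
    have h (a : Fin (k + 1)) : wedge ((-((m - 1 : ℕ) : ℂ) * G a) • dzCov a)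
        (∑ i, ∑ j, (f y * φ.rep c y i j) • wedge (dzbarCov j) (contract i (dZ (k + 1))))
        = ∑ j, (((m : ℂ) - 1) * (G a * (f y * φ.rep c y a j))) • W j := by
      simp only [smul_wedge, wedge_sum, wedge_smul, wedge_dzCov_wedge_contract_dZ]
      rw [Finset.sum_eq_single a (fun i _ hi => by simp [hi.symm]) (by simp)]
      refine Finset.sum_congr rfl fun j _ => ?_
      rw [if_pos rfl, smul_neg, smul_neg, smul_smul, ← cov_neg_smul, Nat.cast_sub hm]
      congr 1
      push_cast
      ring
    refine (Finset.sum_congr rfl fun a _ => h a).trans ?_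
    rw [Finset.sum_comm]
    simp only [← cov_sum_smul, Finset.mul_sum]
  have h4 : wedge (divergence g φ c y) (σ.rep c y)
      = ∑ j, ((∑ i, dz i (fun x => φ.rep c x i j) y + ∑ i, φ.rep c y i j * G i) * f y) • W j := by
    rw [divergence_eq g φ hc hy, hσf.eq_of_nhds, sum_wedge]
    refine Finset.sum_congr rfl fun j _ => ?_
    rw [smul_wedge, wedge_smul, smul_smul]
  have h5 (j : Fin (k + 1)) : ∑ i, dz i (fun x => f x * φ.rep c x i j) y
      = ∑ i, f y * dz i (fun x => φ.rep c x i j) y + ∑ i, φ.rep c y i j * dz i f y := by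
    rw [← Finset.sum_add_distrib]
    exact Finset.sum_congr rfl fun i _ => dz_mul hf (hφ i j) i
  have h6 : delbar (σ.rep c) y - (-nablaPrime g (m - 1) c
        (fun x => contraction (φ.rep c x) (σ.rep c x)) y
        + ((m : ℂ) - 1) • wedge (divergence g φ c y) (σ.rep c y))
      = ∑ j, (dzbar j f y - (∑ i, φ.rep c y i j * dz i f y
        + m * f y * ∑ i, dz i (fun x => φ.rep c x i j) y)) • W j := by
    rw [nablaPrime, h1, h2, h3, h4, Finset.smul_sum, ← Finset.sum_add_distrib,
      ← Finset.sum_neg_distrib, ← Finset.sum_add_distrib, ← Finset.sum_sub_distrib]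
    refine Finset.sum_congr rfl fun j _ => ?_
    rw [smul_smul, ← cov_add_smul, ← cov_neg_smul, ← cov_add_smul, ← cov_sub_smul, h5]
    congr 1
    have h7 : ∑ i, G i * (f y * φ.rep c y i j) = f y * ∑ i, φ.rep c y i j * G i := by
      rw [Finset.mul_sum]
      exact Finset.sum_congr rfl fun i _ => by ring
    rw [h7, ← Finset.mul_sum]
    ring
  rw [← sub_eq_zero, h6]
  constructor
  · intro h j
    have h0 := eq_zero_of_sum_smul_wedge_frame (Φ := 0) (by rw [frame_zero]; exact dZ_ne_zero) _
      (by rw [frame_zero]; exact h) j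
    exact sub_eq_zero.mp h0
  · intro h
    refine Finset.sum_eq_zero fun j _ => ?_
    rw [sub_eq_zero.mpr (h j), cov_zero_smul]

end Divergence

end Coordinates

/-! ### The exterior derivative of the frame of `K_{M_φ}` -/

section FrameDerivative

variable {n : ℕ}

/-- The wedge product of `n` covectors as a continuous multilinear map. -/
def wedgeAllMultilinear (n : ℕ) :
    ContinuousMultilinearMap ℝ (fun _ : Fin n => Cn n →L[ℝ] ℂ) (Cov n n) where
  toFun := wedgeAll
  map_update_add' := fun {inst} l i η ξ => by
    obtain rfl := Subsingleton.elim inst (instDecidableEqFin n)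
    exact wedgeAll_update_add l i η ξ
  map_update_smul' := fun {inst} l i a η => by
    obtain rfl := Subsingleton.elim inst (instDecidableEqFin n)
    exact wedgeAll_update_smul l i a η
  cont := by
    have h1 : Continuous fun g : Cn n →L[ℝ] Cn n => (dZ n).compContinuousLinearMap g :=
      continuous_iff_continuousAt.mpr fun g =>
        (differentiableAt_const (dZ n)).continuousAlternatingMapCompContinuousLinearMap
          differentiableAt_id |>.continuousAt
    have h2 : Continuous fun l : Fin n → (Cn n →L[ℝ] ℂ) => ContinuousLinearMap.pi l := by
      have h (l : Fin n → (Cn n →L[ℝ] ℂ)) : ContinuousLinearMap.pi l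
          = ∑ i, (ContinuousLinearMap.single ℝ (fun _ : Fin n => ℂ) i).comp (l i) := by
        ext v j
        simp [Pi.single_apply]
      simp only [h]
      fun_prop
    exact h1.comp h2

theorem coframe_eq_sum (Φ : Matrix (Fin n) (Fin n) ℂ) (i : Fin n) :
    coframe Φ i = dzCov i + ∑ j, Φ i j • dzbarCov j := rfl

variable {Φ : Cn n → Matrix (Fin n) (Fin n) ℂ} {y : Cn n}

theorem differentiableAt_coframe (hΦ : ∀ i j, DifferentiableAt ℝ (fun x => Φ x i j) y)
    (i : Fin n) : DifferentiableAt ℝ (fun x => coframe (Φ x) i) y := by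
  simp only [coframe_eq_sum]
  exact (DifferentiableAt.fun_sum fun j _ => (hΦ i j).smul_const _).const_add _

theorem fderiv_coframe (hΦ : ∀ i j, DifferentiableAt ℝ (fun x => Φ x i j) y) (i : Fin n) :
    fderiv ℝ (fun x => coframe (Φ x) i) y
      = ∑ j, (fderiv ℝ (fun x => Φ x i j) y).smulRight (dzbarCov j) := by
  simp only [coframe_eq_sum]
  exact ((HasFDerivAt.fun_sum fun j _ =>
    (hΦ i j).hasFDerivAt.smul_const (dzbarCov j)).const_add (dzCov i)).fderiv

theorem contDiffOn_frame {s : Set (Cn n)} (hΦ : ∀ i j, ContDiffOn ℝ ∞ (fun x => Φ x i j) s) :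
    ContDiffOn ℝ ∞ (fun x => frame (Φ x)) s := by
  refine (wedgeAllMultilinear n).contDiff.comp_contDiffOn (contDiffOn_pi.mpr fun i => ?_)
  exact contDiffOn_const.add (ContDiffOn.sum fun j _ => (hΦ i j).smul contDiffOn_const)

theorem hasFDerivAt_frame (hΦ : ∀ i j, DifferentiableAt ℝ (fun x => Φ x i j) y) :
    HasFDerivAt (fun x => frame (Φ x))
      (((wedgeAllMultilinear n).linearDeriv (coframe (Φ y))).comp
        (ContinuousLinearMap.pi fun i => fderiv ℝ (fun x => coframe (Φ x) i) y)) y :=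
  ((wedgeAllMultilinear n).hasFDerivAt (coframe (Φ y))).comp y
    (hasFDerivAt_pi.mpr fun i => (differentiableAt_coframe hΦ i).hasFDerivAt)

theorem fderiv_frame_apply (hΦ : ∀ i j, DifferentiableAt ℝ (fun x => Φ x i j) y) (x : Cn n) :
    fderiv ℝ (fun x => frame (Φ x)) y x = ∑ i, wedgeAll (Function.update (coframe (Φ y)) i
      (fderiv ℝ (fun x => coframe (Φ x) i) y x)) := by
  rw [(hasFDerivAt_frame hΦ).fderiv, ContinuousLinearMap.comp_apply,
    ContinuousMultilinearMap.linearDeriv_apply]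
  rfl

/-- `wedgeAll` is complex linear in each argument. -/
def wedgeAllUpdate (l : Fin n → (Cn n →L[ℝ] ℂ)) (i : Fin n) :
    (Cn n →L[ℝ] ℂ) →ₗ[ℂ] Cov n n where
  toFun η := wedgeAll (Function.update l i η)
  map_add' := wedgeAll_update_add l i
  map_smul' := wedgeAll_update_smul l i

theorem dz_coframe (hΦ : ∀ i j, DifferentiableAt ℝ (fun x => Φ x i j) y) (k i : Fin n) :
    dz k (fun x => coframe (Φ x) i) y = ∑ j, dz k (fun x => Φ x i j) y • dzbarCov j := by
  rw [dz, fderiv_coframe hΦ, linPart_sum, _root_.sum_apply]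
  simp only [linPart_smulRight]
  rfl

theorem dzbar_coframe (hΦ : ∀ i j, DifferentiableAt ℝ (fun x => Φ x i j) y) (k i : Fin n) :
    dzbar k (fun x => coframe (Φ x) i) y = ∑ j, dzbar k (fun x => Φ x i j) y • dzbarCov j := by
  rw [dzbar, fderiv_coframe hΦ, antiPart_sum, _root_.sum_apply]
  simp only [antiPart_smulRight]
  rfl

theorem dz_frame (hΦ : ∀ i j, DifferentiableAt ℝ (fun x => Φ x i j) y) (k : Fin n) :
    dz k (fun x => frame (Φ x)) y
      = ∑ i, ∑ j, dz k (fun x => Φ x i j) y •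
          wedgeAll (Function.update (coframe (Φ y)) i (dzbarCov j)) := by
  have h : dz k (fun x => frame (Φ x)) y
      = ∑ i, wedgeAllUpdate (coframe (Φ y)) i (dz k (fun x => coframe (Φ x) i) y) := by
    simp only [dz, linPart_apply, fderiv_frame_apply hΦ, map_sub, map_smul,
      Finset.smul_sum, ← Finset.sum_sub_distrib]
    rfl
  rw [h]
  simp only [dz_coframe hΦ, map_sum, map_smul]
  rfl

theorem dzbar_frame (hΦ : ∀ i j, DifferentiableAt ℝ (fun x => Φ x i j) y) (k : Fin n) :
    dzbar k (fun x => frame (Φ x)) y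
      = ∑ i, ∑ j, dzbar k (fun x => Φ x i j) y •
          wedgeAll (Function.update (coframe (Φ y)) i (dzbarCov j)) := by
  have h : dzbar k (fun x => frame (Φ x)) y
      = ∑ i, wedgeAllUpdate (coframe (Φ y)) i (dzbar k (fun x => coframe (Φ x) i) y) := by
    simp only [dzbar, antiPart_apply, fderiv_frame_apply hΦ, map_add, map_smul,
      Finset.smul_sum, ← Finset.sum_add_distrib]
    rfl
  rw [h]
  simp only [dzbar_coframe hΦ, map_sum, map_smul]
  rfl

/-- The integrability condition `∂̄φ = ½ [φ,φ]` in coordinates. -/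
theorem integrable_coordinates (hΦ : ∀ i j, DifferentiableAt ℝ (fun x => Φ x i j) y) (i : Fin n)
    (hint : delbar (fun x => toCov (comp01 (Φ x) i)) y = (1 / 2 : ℂ) • bracket Φ Φ i y)
    (k j : Fin n) :
    dzbar k (fun x => Φ x i j) y - dzbar j (fun x => Φ x i k) y
      = ∑ l, (Φ y l k * dz l (fun x => Φ x i j) y - Φ y l j * dz l (fun x => Φ x i k) y) := by
  have h1 (a : Fin n) : dz a (fun x => toCov (comp01 (Φ x) i)) y
      = toCov (∑ b, dz a (fun x => Φ x i b) y • dzbarCov b) := by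
    simp only [toCov_comp01, toCov_sum, toCov_smul]
    rw [dz_sum fun b _ => (hΦ i b).smul_const _]
    exact Finset.sum_congr rfl fun b _ => dz_smul_const (hΦ i b) _ _
  have h2 (a : Fin n) : dzbar a (fun x => toCov (comp01 (Φ x) i)) y
      = toCov (∑ b, dzbar a (fun x => Φ x i b) y • dzbarCov b) := by
    simp only [toCov_comp01, toCov_sum, toCov_smul]
    rw [dzbar_sum fun b _ => (hΦ i b).smul_const _]
    exact Finset.sum_congr rfl fun b _ => dzbar_smul_const (hΦ i b) _ _
  have h3 : ∑ a, wedge (dzbarCov a) (toCov (∑ b, dzbar a (fun x => Φ x i b) y • dzbarCov b))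
      = ∑ a, wedge (comp01 (Φ y) a) (toCov (∑ b, dz a (fun x => Φ x i b) y • dzbarCov b)) := by
    rw [delbar_eq_sum, bracket, Finset.smul_sum] at hint
    simp only [h1, h2] at hint
    rw [hint]
    exact Finset.sum_congr rfl fun a _ => by module
  -- evaluate both sides on the vectors `∂̄_k`, `∂̄_j`
  have h4 (θ η : Fin n → (Cn n →L[ℝ] ℂ)) :
      antiPart (ofCov (antiPart (∑ a, wedge (θ a) (toCov (η a))).curryLeft (stdVec k))) (stdVec j)
        = ∑ a, (antiPart (θ a) (stdVec k) * antiPart (η a) (stdVec j)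
          - antiPart (η a) (stdVec k) * antiPart (θ a) (stdVec j)) := by
    have h5 (α β : Cov n 2) : (α + β).curryLeft = α.curryLeft + β.curryLeft := rfl
    have h6 (s : Finset (Fin n)) (α : Fin n → Cov n 2) :
        antiPart (∑ a ∈ s, α a).curryLeft (stdVec k)
          = ∑ a ∈ s, antiPart (α a).curryLeft (stdVec k) := by
      classical
      induction s using Finset.induction_on with
      | empty =>
        have h0 : (0 : Cov n 2).curryLeft = 0 := by ext; simp
        simp [h0]
      | insert a s ha ih => rw [Finset.sum_insert ha, Finset.sum_insert ha, ← ih]; simp [h5]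
    have h7 (α β : Cn n →L[ℝ] ℂ) : antiPart (wedge α (toCov β)).curryLeft (stdVec k)
        = toCov (antiPart α (stdVec k) • β + (-antiPart β (stdVec k)) • α) := by
      rw [antiPart_curryLeft_wedge]
      ext v
      have h (w : Fin 0 → Cn n) :
          antiPart (toCov β).curryLeft (stdVec k) w = antiPart β (stdVec k) := rfl
      have h' : wedge α (antiPart (toCov β).curryLeft (stdVec k)) v
          = α (v 0) * antiPart β (stdVec k) := by
        rw [wedge_apply]
        simp [h]
      change antiPart α (stdVec k) * β (v 0)
        - wedge α (antiPart (toCov β).curryLeft (stdVec k)) v = _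
      rw [h']
      simp [toCov_apply]
      ring
    rw [h6]
    simp only [h7, ← toCov_sum, ofCov_toCov, antiPart_sum, _root_.sum_apply, antiPart_add,
      antiPart_smul, _root_.add_apply, _root_.smul_apply, smul_eq_mul]
    exact Finset.sum_congr rfl fun a _ => by ring
  have h8 := congrArg
    (fun α : Cov n 2 => antiPart (ofCov (antiPart α.curryLeft (stdVec k))) (stdVec j)) h3
  simp only [h4] at h8
  have h9 (c : Fin n → ℂ) (b : Fin n) : antiPart (∑ a, c a • dzbarCov a) (stdVec b) = c b := by
    simp
  simp only [h9, antiPart_comp01, antiPart_dzbarCov, Finset.sum_sub_distrib] at h8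
  rw [Finset.sum_sub_distrib]
  simpa [mul_comm] using h8

/-- By integrability, `dφ^i = ∑_l e^l ∧ ∂_l φ^i`, so that the exterior derivative of the frame
`e^1 ∧ ⋯ ∧ e^n` is `-∑_j (∑_i ∂_i φ^i_{j̄}) dz̄^j ∧ e^1 ∧ ⋯ ∧ e^n`. -/
theorem extDeriv_frame (hΦ : ∀ i j, DifferentiableAt ℝ (fun x => Φ x i j) y)
    (hint : ∀ i, delbar (fun x => toCov (comp01 (Φ x) i)) y = (1 / 2 : ℂ) • bracket Φ Φ i y) :
    extDeriv (fun x => frame (Φ x)) y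
      = ∑ j, (-∑ i, dz i (fun x => Φ x i j) y) • wedge (dzbarCov j) (frame (Φ y)) := by
  set U : Fin n → Fin n → Cov n n :=
    fun i j => wedgeAll (Function.update (coframe (Φ y)) i (dzbarCov j)) with hU
  have hanti (i k j : Fin n) : wedge (dzbarCov k) (U i j) = -wedge (dzbarCov j) (U i k) :=
    wedge_wedgeAll_update_swap _ _ _ _
  -- the symmetric coefficients `∂̄_k φ^i_{j̄} - φ^l_{k̄} ∂_l φ^i_{j̄}` do not contribute
  have hsymm (i : Fin n) : ∑ k, ∑ j, (dzbar k (fun x => Φ x i j) y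
      - ∑ l, Φ y l k * dz l (fun x => Φ x i j) y) • wedge (dzbarCov k) (U i j) = 0 := by
    set A : Fin n → Fin n → ℂ := fun k j => dzbar k (fun x => Φ x i j) y
      - ∑ l, Φ y l k * dz l (fun x => Φ x i j) y with hA
    have hA' (k j : Fin n) : A k j = A j k := by
      have h := integrable_coordinates hΦ i (hint i) k j
      rw [Finset.sum_sub_distrib] at h
      simp only [hA]
      linear_combination h
    have h1 : ∑ k, ∑ j, A k j • wedge (dzbarCov k) (U i j)
        = -∑ k, ∑ j, A k j • wedge (dzbarCov k) (U i j) := by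
      conv_lhs => rw [Finset.sum_comm]
      simp only [← Finset.sum_neg_distrib]
      refine Finset.sum_congr rfl fun j _ => Finset.sum_congr rfl fun k _ => ?_
      rw [hA', hanti, smul_neg]
    ext v
    exact self_eq_neg.mp (congrArg (fun α : Cov n (n + 1) => α v) h1)
  have hbar (i : Fin n) : ∑ k, ∑ j, dzbar k (fun x => Φ x i j) y • wedge (dzbarCov k) (U i j)
      = ∑ l, ∑ j, dz l (fun x => Φ x i j) y • wedge (comp01 (Φ y) l) (U i j) := by
    have h := hsymm i
    simp only [cov_sub_smul, Finset.sum_sub_distrib] at h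
    rw [sub_eq_zero.mp h]
    simp only [comp01, sum_wedge, smul_wedge, cov_sum_smul, Finset.smul_sum, smul_smul]
    have h' (k : Fin n) : ∑ j, ∑ l, (Φ y l k * dz l (fun x => Φ x i j) y) •
          wedge (dzbarCov k) (U i j)
        = ∑ l, ∑ j, (dz l (fun x => Φ x i j) y * Φ y l k) • wedge (dzbarCov k) (U i j) := by
      rw [Finset.sum_comm]
      simp only [mul_comm]
    simp only [h']
    rw [Finset.sum_comm]
    refine Finset.sum_congr rfl fun l _ => ?_
    rw [Finset.sum_comm]
  have hcoframe (i l j : Fin n) : wedge (coframe (Φ y) l) (U i j)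
      = if l = i then -wedge (dzbarCov j) (frame (Φ y)) else 0 := by
    split_ifs with h
    · subst h
      rw [hU, wedge_wedgeAll_update_swap, Function.update_eq_self, frame_eq_wedgeAll]
    · have h1 := wedge_wedgeAll_of_mem (Function.update (coframe (Φ y)) i (dzbarCov j)) l
      rwa [Function.update_of_ne h] at h1
  have hi (i : Fin n) :
      ∑ k, ∑ j, dz k (fun x => Φ x i j) y • wedge (dzCov k) (U i j)
        + ∑ k, ∑ j, dzbar k (fun x => Φ x i j) y • wedge (dzbarCov k) (U i j)
      = ∑ j, dz i (fun x => Φ x i j) y • -wedge (dzbarCov j) (frame (Φ y)) := by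
    rw [hbar, ← Finset.sum_add_distrib]
    have h (l : Fin n) : ∑ j, dz l (fun x => Φ x i j) y • wedge (dzCov l) (U i j)
          + ∑ j, dz l (fun x => Φ x i j) y • wedge (comp01 (Φ y) l) (U i j)
        = ∑ j, dz l (fun x => Φ x i j) y •
            if l = i then -wedge (dzbarCov j) (frame (Φ y)) else 0 := by
      rw [← Finset.sum_add_distrib]
      refine Finset.sum_congr rfl fun j _ => ?_
      rw [← hcoframe i l j, coframe, add_wedge]
      exact (smul_add _ _ _).symm
    simp only [h]
    rw [Finset.sum_eq_single i (fun l _ hl => by simp [hl]) (by simp)]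
    simp
  rw [extDeriv_eq_sum]
  simp only [dz_frame hΦ, dzbar_frame hΦ, wedge_sum, wedge_smul]
  rw [Finset.sum_comm (γ := Fin n), Finset.sum_comm (γ := Fin n) (f := fun k i =>
    ∑ j, dzbar k (fun x => Φ x i j) y • wedge (dzbarCov k) (U i j)), ← Finset.sum_add_distrib]
  rw [Finset.sum_congr rfl fun i _ => hi i, Finset.sum_comm]
  refine Finset.sum_congr rfl fun j _ => ?_
  rw [← cov_sum_smul, smul_neg, cov_neg_smul]

end FrameDerivative

/-! ### Tensor powers -/

section TensorPower

variable {V : Type*} [AddCommGroup V] [Module ℂ V] {m : ℕ}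

theorem tprod_const_smul (a : ℂ) (x : V) :
    (PiTensorProduct.tprod ℂ fun _ : Fin m => a • x)
      = a ^ m • PiTensorProduct.tprod ℂ fun _ : Fin m => x := by
  rw [(PiTensorProduct.tprod ℂ).map_smul_univ (fun _ : Fin m => a) fun _ => x]
  simp

theorem tprod_const_ne_zero {x : V} (hx : x ≠ 0) :
    (PiTensorProduct.tprod ℂ fun _ : Fin m => x) ≠ 0 := by
  obtain ⟨l, hl⟩ : ∃ l : Module.Dual ℂ V, l x ≠ 0 := by
    by_contra! h
    exact hx ((Module.forall_dual_apply_eq_zero_iff ℂ x).mp h)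
  intro h
  have h1 := congrArg (PiTensorProduct.lift
    ((MultilinearMap.mkPiAlgebra ℂ (Fin m) ℂ).compLinearMap fun _ => l)) h
  rw [PiTensorProduct.lift.tprod, map_zero] at h1
  simp [hl] at h1

theorem smul_tprod_const_injective {x : V} (hx : x ≠ 0) {a b : ℂ}
    (h : (a • PiTensorProduct.tprod ℂ fun _ : Fin m => x)
      = b • PiTensorProduct.tprod ℂ fun _ : Fin m => x) : a = b :=
  smul_left_injective ℂ (tprod_const_ne_zero hx) h

end TensorPower

/-! ### The Beltrami condition -/

section Beltrami

variable {n : ℕ} {Φ : Matrix (Fin n) (Fin n) ℂ}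

/-- If `1` is not an eigenvalue of `φ φ̄`, the coframe `(e^1, …, e^n)` is injective, hence onto, as
a real linear map to `ℂⁿ`: a vector with `v = -φ v̄` satisfies `v = φ φ̄ v`. -/
theorem frame_ne_zero (hΦ : ¬ Module.End.HasEigenvalue
    (Matrix.toLin' (Φ * Φ.map (starRingEnd ℂ))) 1) : frame Φ ≠ 0 := by
  let e : Cn n →L[ℝ] Cn n := ContinuousLinearMap.pi (coframe Φ)
  have he (v : Cn n) : e v = v + Φ *ᵥ (fun j => starRingEnd ℂ (v j)) := by
    ext i
    simp [e, coframe, comp01_apply, Matrix.mulVec, dotProduct]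
  have hinj : Function.Injective (e : Cn n →ₗ[ℝ] Cn n) := by
    rw [injective_iff_map_eq_zero]
    intro v hv
    by_contra hv0
    apply hΦ
    have h1 : v = -(Φ *ᵥ fun j => starRingEnd ℂ (v j)) := by
      have := (he v).symm.trans hv
      exact eq_neg_of_add_eq_zero_left this
    have h2 : (fun j => starRingEnd ℂ (v j)) = -(Φ.map (starRingEnd ℂ) *ᵥ v) := by
      ext j
      conv_lhs => rw [h1]
      simp [Matrix.mulVec, dotProduct]
    have h3 : Matrix.toLin' (Φ * Φ.map (starRingEnd ℂ)) v = (1 : ℂ) • v := by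
      rw [Matrix.toLin'_apply, ← Matrix.mulVec_mulVec, one_smul]
      conv_rhs => rw [h1, h2]
      rw [Matrix.mulVec_neg, neg_neg]
    exact Module.End.hasEigenvalue_of_hasEigenvector
      ⟨Module.End.mem_eigenspace_iff.mpr h3, hv0⟩
  have hsurj := LinearMap.injective_iff_surjective.mp hinj
  choose u hu using fun i : Fin n => hsurj (stdVec i)
  intro h
  have h1 : frame Φ u = coeff (dZ n) := by
    change dZ n (fun j => e (u j)) = _
    rw [coeff]
    congr 1
    funext j
    exact hu j
  rw [h, coeff_dZ] at h1
  exact zero_ne_one h1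

end Beltrami

/-! ### The `∂̄`-operator of `K_{M_φ}^{⊗ m}` in coordinates -/

section DbarClosed

variable {n : ℕ}

/-- As `e^i ∧ F = 0` for `F = e^1 ∧ ⋯ ∧ e^n`, the covector `dz^i ∧ F` is `-φ^i ∧ F`, so that
`θ ∧ F` only depends on the values of `θ` on the vectors `∂̄_j - φ^i_{j̄} ∂_i`. -/
theorem wedge_frame (Φ : Matrix (Fin n) (Fin n) ℂ) (θ : Cn n →L[ℝ] ℂ) :
    wedge θ (frame Φ) = ∑ j, (antiPart θ (stdVec j) - ∑ i, Φ i j * linPart θ (stdVec i)) •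
      wedge (dzbarCov j) (frame Φ) := by
  have h (i : Fin n) : wedge (dzCov i) (frame Φ)
      = ∑ j, (-Φ i j) • wedge (dzbarCov j) (frame Φ) := by
    have h1 := wedge_wedgeAll_of_mem (coframe Φ) i
    rw [← frame_eq_wedgeAll, coframe, add_wedge] at h1
    rw [eq_neg_of_add_eq_zero_left h1, comp01, sum_wedge, ← Finset.sum_neg_distrib]
    exact Finset.sum_congr rfl fun j _ => by rw [smul_wedge, cov_neg_smul]
  conv_lhs => rw [eq_sum_dzCov θ]
  simp only [add_wedge, sum_wedge, smul_wedge, h, Finset.smul_sum, smul_smul]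
  rw [Finset.sum_comm, ← Finset.sum_add_distrib]
  refine Finset.sum_congr rfl fun j _ => ?_
  rw [← cov_sum_smul, ← cov_add_smul]
  congr 1
  rw [sub_eq_neg_add, ← Finset.sum_neg_distrib]
  congr 1
  exact Finset.sum_congr rfl fun i _ => by ring

/-- In the frame `F = e^1 ∧ ⋯ ∧ e^n` of `K_{M_φ}`, the equation `df ∧ F + m f dF = 0` is the local
equation for `f`. -/
theorem wedge_fderiv_add_extDeriv_frame_eq_zero_iff
    {Φ : Cn n → Matrix (Fin n) (Fin n) ℂ} {y : Cn n}
    (hΦ : ∀ i j, DifferentiableAt ℝ (fun x => Φ x i j) y)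
    (hint : ∀ i, delbar (fun x => toCov (comp01 (Φ x) i)) y = (1 / 2 : ℂ) • bracket Φ Φ i y)
    (hF : frame (Φ y) ≠ 0) (f : Cn n → ℂ) (m : ℕ) :
    wedge (fderiv ℝ f y) (frame (Φ y)) + ((m : ℂ) * f y) • extDeriv (fun x => frame (Φ x)) y = 0
      ↔ ∀ j, dzbar j f y = ∑ i, Φ y i j * dz i f y
        + m * f y * ∑ i, dz i (fun x => Φ x i j) y := by
  have h : wedge (fderiv ℝ f y) (frame (Φ y))
        + ((m : ℂ) * f y) • extDeriv (fun x => frame (Φ x)) y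
      = ∑ j, (dzbar j f y - (∑ i, Φ y i j * dz i f y
        + m * f y * ∑ i, dz i (fun x => Φ x i j) y)) • wedge (dzbarCov j) (frame (Φ y)) := by
    rw [wedge_frame, extDeriv_frame hΦ hint, Finset.smul_sum, ← Finset.sum_add_distrib]
    refine Finset.sum_congr rfl fun j _ => ?_
    rw [smul_smul, ← cov_add_smul]
    congr 1
    simp only [dz, dzbar]
    ring
  rw [h]
  constructor
  · intro h0 j
    exact sub_eq_zero.mp (eq_zero_of_sum_smul_wedge_frame hF _ h0 j)
  · intro h0
    refine Finset.sum_eq_zero fun j _ => ?_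
    rw [sub_eq_zero.mpr (h0 j), cov_zero_smul]

theorem extDeriv_smul_frame {F : Cn n → Cov n n} {u : Cn n → ℂ} {y : Cn n}
    (hu : DifferentiableAt ℝ u y) (hF : DifferentiableAt ℝ F y) :
    extDeriv (fun x => u x • F x) y = wedge (fderiv ℝ u y) (F y) + u y • extDeriv F y := by
  have h : HasFDerivAt (fun x => u x • F x) _ y := hu.hasFDerivAt.smul hF.hasFDerivAt
  rw [extDeriv, h.fderiv,
    ContinuousAlternatingMap.alternatizeUncurryFin_add,
    ContinuousAlternatingMap.alternatizeUncurryFin_smul]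
  exact add_comm _ _

variable {M : Type*} [TopologicalSpace M] [ChartedSpace (Cn n) M]

theorem TwistedForm.contDiffOn_coeff {r : ℕ} (σ : TwistedForm n M r n)
    {c : OpenPartialHomeomorph M (Cn n)} (hc : c ∈ holCharts n M) :
    ContDiffOn ℝ ∞ (fun x => coeff (σ.rep c x)) c.target :=
  (ContinuousAlternatingMap.apply ℝ (Cn n) ℂ (fun i => stdVec i)).contDiff.comp_contDiffOn
    (σ.smooth c hc)

/-- A local frame `β` of `K_{M_φ}` is `u F` with `F = e^1 ∧ ⋯ ∧ e^n` and `u` nowhere zero, and the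
equation for `h β^{⊗ m}` is that for `h u^m F^{⊗ m}` up to a power of `u`. -/
theorem isDbarClosedOn_iff_localEqOn {φ : VectorForm n M} (hφ : φ.IsBeltrami)
    (hint : φ.IsIntegrable) {m : ℕ} {σ : TwistedForm n M (m - 1) n}
    {c : OpenPartialHomeomorph M (Cn n)} (hc : c ∈ holCharts n M) :
    IsDbarClosedOn φ m (rho φ m σ) c ↔ LocalEqOn φ m σ c := by
  set f : Cn n → ℂ := fun x => coeff (σ.rep c x) with hf_def
  have hF (y) (hy : y ∈ c.target) : frame (φ.rep c y) ≠ 0 := frame_ne_zero (hφ c hc y hy)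
  have key (y) (hy : y ∈ c.target) := wedge_fderiv_add_extDeriv_frame_eq_zero_iff
    (φ.differentiableAt hc hy) (hint c hc y hy) (hF y hy) f m
  have hFsmooth : ContDiffOn ℝ ∞ (fun x => frame (φ.rep c x)) c.target :=
    contDiffOn_frame (φ.smooth c hc)
  constructor
  · intro h y hy
    refine (key y hy).mp ?_
    obtain ⟨W, hWo, hyW, hWc, h, β, hh, hβ, hW⟩ := h y hy
    have hFy : DifferentiableAt ℝ (fun x => frame (φ.rep c x)) y :=
      (hFsmooth.contDiffAt (c.open_target.mem_nhds hy)).differentiableAt (by simp)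
    have hhy : DifferentiableAt ℝ h y :=
      (hh.contDiffAt (hWo.mem_nhds hyW)).differentiableAt (by simp)
    have hβy : DifferentiableAt ℝ β y :=
      (hβ.contDiffAt (hWo.mem_nhds hyW)).differentiableAt (by simp)
    -- near `y`, `β = u F` with `u` the quotient of the values at a fixed tuple of vectors
    obtain ⟨v, hv⟩ : ∃ v, frame (φ.rep c y) v ≠ 0 := by
      by_contra! h0
      exact hF y hy (ContinuousAlternatingMap.ext h0)
    have hev {α : Cn n → Cov n n} (hα : DifferentiableAt ℝ α y) :
        DifferentiableAt ℝ (fun x => α x v) y :=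
      (ContinuousAlternatingMap.apply ℝ (Cn n) ℂ v).differentiableAt.comp y hα
    let u : Cn n → ℂ := fun x => β x v / frame (φ.rep c x) v
    have hu : DifferentiableAt ℝ u y :=
      (hev hβy).mul ((hev hFy).fun_inv hv)
    have hnear : ∀ᶠ x in nhds y, x ∈ W ∧ frame (φ.rep c x) v ≠ 0 :=
      (hWo.eventually_mem hyW).and ((hev hFy).continuousAt.eventually_ne hv)
    have hβu : β =ᶠ[nhds y] fun x => u x • frame (φ.rep c x) := by
      filter_upwards [hnear] with x hx
      obtain ⟨a, ha⟩ := Submodule.mem_span_singleton.mp (hW x hx.1).2.1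
      have h1 : a * frame (φ.rep c x) v = β x v := congrArg (fun α : Cov n n => α v) ha
      rw [← ha]
      congr 1
      exact eq_div_of_mul_eq hx.2 h1
    have hfu : f =ᶠ[nhds y] fun x => h x * u x ^ m := by
      filter_upwards [hnear, hβu] with x hx hx'
      have h1 := (hW x hx.1).2.2.1
      rw [hx', tprod_const_smul, smul_smul] at h1
      exact smul_tprod_const_injective (hF x (hWc hx.1)) h1
    have heq := (hW y hyW).2.2.2
    have huy : u y ≠ 0 := fun h0 => (hW y hyW).1 (by rw [hβu.eq_of_nhds, h0, cov_zero_smul])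
    rw [hβu.extDeriv_eq, hβu.eq_of_nhds, extDeriv_smul_frame hu hFy] at heq
    have hdf : fderiv ℝ f y
        = (u y ^ m) • fderiv ℝ h y + (h y * (m * u y ^ (m - 1))) • fderiv ℝ u y := by
      rw [hfu.fderiv_eq, fderiv_fun_mul hhy (hu.fun_pow m), fderiv_fun_pow m hu, add_comm]
      ext x
      simp
      ring
    rw [hdf, hfu.eq_of_nhds, add_wedge, smul_wedge, smul_wedge]
    ext w
    have hw := congrArg (fun α : Cov n (n + 1) => α w) heq
    simp only [wedge_smul, ContinuousAlternatingMap.add_apply, ContinuousAlternatingMap.smul_apply,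
      smul_eq_mul, ContinuousAlternatingMap.coe_zero, Pi.zero_apply] at hw ⊢
    have hm : (m : ℂ) * u y ^ m = m * (u y ^ (m - 1) * u y) := by
      cases m with
      | zero => simp
      | succ m => rw [pow_succ]; rfl
    apply mul_left_cancel₀ huy
    linear_combination u y ^ m * hw - h y * wedge (fderiv ℝ u y) (frame (φ.rep c y)) w * hm
  · intro h y hy
    refine ⟨c.target, c.open_target, hy, subset_rfl, f, fun x => frame (φ.rep c x),
      σ.contDiffOn_coeff hc, hFsmooth, fun x hx => ⟨hF x hx, Submodule.mem_span_singleton_self _,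
        rfl, (key x hx).mpr (h x hx)⟩⟩

end DbarClosed

/-! ### Holomorphic coordinates of the deformed structure -/

section SecondDerivatives

variable {n : ℕ} {v : Cn n → ℂ} {y : Cn n}

theorem hasFDerivAt_fderiv_apply (hv : ContDiffAt ℝ ∞ v y) (a : Cn n) :
    HasFDerivAt (fun x => fderiv ℝ v x a) ((fderiv ℝ (fderiv ℝ v) y).flip a) y := by
  have h1 : DifferentiableAt ℝ (fderiv ℝ v) y :=
    (hv.fderiv_right (m := 1) (by norm_cast)).differentiableAt (by simp)
  exact ((ContinuousLinearMap.apply ℝ ℂ a).hasFDerivAt.comp y h1.hasFDerivAt).congr_fderiv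
    (by ext; rfl)

theorem hasFDerivAt_dz (hv : ContDiffAt ℝ ∞ v y) (i : Fin n) :
    HasFDerivAt (dz i v) ((1 / 2 : ℂ) • ((fderiv ℝ (fderiv ℝ v) y).flip (stdVec i)
      - Complex.I • (fderiv ℝ (fderiv ℝ v) y).flip (Complex.I • stdVec i))) y :=
  ((hasFDerivAt_fderiv_apply hv _).sub
    ((hasFDerivAt_fderiv_apply hv _).const_smul Complex.I)).const_smul (1 / 2 : ℂ)

theorem hasFDerivAt_dzbar (hv : ContDiffAt ℝ ∞ v y) (i : Fin n) :
    HasFDerivAt (dzbar i v) ((1 / 2 : ℂ) • ((fderiv ℝ (fderiv ℝ v) y).flip (stdVec i)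
      + Complex.I • (fderiv ℝ (fderiv ℝ v) y).flip (Complex.I • stdVec i))) y :=
  ((hasFDerivAt_fderiv_apply hv _).add
    ((hasFDerivAt_fderiv_apply hv _).const_smul Complex.I)).const_smul (1 / 2 : ℂ)

theorem fderiv_fderiv_comm (hv : ContDiffAt ℝ ∞ v y) (a b : Cn n) :
    fderiv ℝ (fderiv ℝ v) y a b = fderiv ℝ (fderiv ℝ v) y b a :=
  (hv.isSymmSndFDerivAt (by simp; norm_cast)).eq a b

theorem dz_dz_comm (hv : ContDiffAt ℝ ∞ v y) (i l : Fin n) :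
    dz l (dz i v) y = dz i (dz l v) y := by
  rw [dz, dz, (hasFDerivAt_dz hv i).fderiv, (hasFDerivAt_dz hv l).fderiv]
  simp only [linPart_apply, _root_.smul_apply, _root_.sub_apply, ContinuousLinearMap.flip_apply,
    smul_eq_mul]
  rw [fderiv_fderiv_comm hv (stdVec l), fderiv_fderiv_comm hv (stdVec l),
    fderiv_fderiv_comm hv (Complex.I • stdVec l), fderiv_fderiv_comm hv (Complex.I • stdVec l)]
  ring

theorem dz_dzbar_comm (hv : ContDiffAt ℝ ∞ v y) (j l : Fin n) :
    dz l (dzbar j v) y = dzbar j (dz l v) y := by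
  rw [dz, dzbar, (hasFDerivAt_dzbar hv j).fderiv, (hasFDerivAt_dz hv l).fderiv]
  simp only [linPart_apply, antiPart_apply, _root_.smul_apply, _root_.sub_apply,
    _root_.add_apply, ContinuousLinearMap.flip_apply, smul_eq_mul]
  rw [fderiv_fderiv_comm hv (stdVec l), fderiv_fderiv_comm hv (stdVec l),
    fderiv_fderiv_comm hv (Complex.I • stdVec l), fderiv_fderiv_comm hv (Complex.I • stdVec l)]
  ring

end SecondDerivatives

section HolomorphicCoordinates

variable {n : ℕ}

/-- The matrix `∂_i w^k` of holomorphic derivatives of a map to `ℂⁿ`. -/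
def holJac (w : Cn n → Cn n) (y : Cn n) : Matrix (Fin n) (Fin n) ℂ :=
  Matrix.of fun k i => dz i (fun x => w x k) y

variable {Φ : Cn n → Matrix (Fin n) (Fin n) ℂ} {w : Cn n → Cn n} {s : Set (Cn n)} {y : Cn n}

theorem fderiv_apply_apply (hw : DifferentiableAt ℝ w y) (v : Cn n) (k : Fin n) :
    fderiv ℝ w y v k = fderiv ℝ (fun x => w x k) y v := by
  have h := (ContinuousLinearMap.proj (R := ℝ) (φ := fun _ : Fin n => ℂ) k).hasFDerivAt.comp y
    hw.hasFDerivAt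
  exact (congrArg (fun L : Cn n →L[ℝ] ℂ => L v) h.fderiv).symm

/-- `dw^k = ∑_i ∂_i w^k e^i`. -/
theorem fderiv_eq_holJac_mulVec (hw : DifferentiableAt ℝ w y)
    (ht : ∀ j k, dzbar j (fun x => w x k) y = ∑ i, Φ y i j * dz i (fun x => w x k) y)
    (v : Cn n) : fderiv ℝ w y v = holJac w y *ᵥ fun i => coframe (Φ y) i v := by
  ext k
  rw [fderiv_apply_apply hw, apply_eq_sum]
  change ∑ i, v i • dz i (fun x => w x k) y
    + ∑ j, (starRingEnd ℂ (v j)) • dzbar j (fun x => w x k) y = _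
  simp only [ht, Matrix.mulVec, dotProduct, coframe, _root_.add_apply, dzCov_apply, comp01_apply,
    holJac, Matrix.of_apply, mul_add, Finset.sum_add_distrib, Finset.mul_sum, smul_eq_mul]
  congr 1
  · exact Finset.sum_congr rfl fun i _ => mul_comm _ _
  · rw [Finset.sum_comm]
    exact Finset.sum_congr rfl fun i _ => Finset.sum_congr rfl fun j _ => by ring

theorem dZ_comp_fderiv (hw : DifferentiableAt ℝ w y)
    (ht : ∀ j k, dzbar j (fun x => w x k) y = ∑ i, Φ y i j * dz i (fun x => w x k) y) :
    (dZ n).compContinuousLinearMap (fderiv ℝ w y) = (holJac w y).det • frame (Φ y) := by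
  ext v
  change (Matrix.of fun j => fderiv ℝ w y (v j)).det
    = (holJac w y).det * (Matrix.of fun j i => coframe (Φ y) i (v j)).det
  rw [← Matrix.det_transpose (holJac w y), mul_comm, ← Matrix.det_mul]
  congr 1
  ext j k
  rw [Matrix.of_apply, fderiv_eq_holJac_mulVec hw ht, Matrix.mul_apply, Matrix.mulVec, dotProduct]
  exact Finset.sum_congr rfl fun i _ => mul_comm _ _

theorem det_holJac_ne_zero (hw : DifferentiableAt ℝ w y)
    (ht : ∀ j k, dzbar j (fun x => w x k) y = ∑ i, Φ y i j * dz i (fun x => w x k) y)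
    (hsurj : Function.Surjective (fderiv ℝ w y)) : (holJac w y).det ≠ 0 := by
  have h : Function.Surjective (holJac w y).mulVec := fun u => by
    obtain ⟨v, hv⟩ := hsurj u
    exact ⟨_, (fderiv_eq_holJac_mulVec hw ht v).symm.trans hv⟩
  exact ((Matrix.isUnit_iff_isUnit_det _).mp (Matrix.mulVec_surjective_iff_isUnit.mp h)).ne_zero

theorem contDiffAt_coord (hs : IsOpen s) (hw : ContDiffOn ℝ ∞ w s) (hy : y ∈ s) (k : Fin n) :
    ContDiffAt ℝ ∞ (fun x => w x k) y :=
  contDiffAt_pi.mp (hw.contDiffAt (hs.mem_nhds hy)) k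

theorem differentiableAt_holJac (hs : IsOpen s) (hw : ContDiffOn ℝ ∞ w s) (hy : y ∈ s)
    (k i : Fin n) : DifferentiableAt ℝ (fun x => holJac w x k i) y :=
  (hasFDerivAt_dz (contDiffAt_coord hs hw hy k) i).differentiableAt

/-- The vector fields `L_j = ∂̄_j - φ^i_{j̄} ∂_i` annihilate the coordinates `w^k`; commuting `L_j`
with `∂_l` gives `L_j (∂_l w^k) = ∑_i ∂_l φ^i_{j̄} ∂_i w^k`. -/
theorem dzbar_holJac (hΦ : ∀ i j, DifferentiableAt ℝ (fun x => Φ x i j) y)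
    (hs : IsOpen s) (hw : ContDiffOn ℝ ∞ w s) (hy : y ∈ s)
    (ht : ∀ x ∈ s, ∀ j k,
      dzbar j (fun x => w x k) x = ∑ i, Φ x i j * dz i (fun x => w x k) x)
    (j k l : Fin n) :
    dzbar j (fun x => holJac w x k l) y = ∑ i, Φ y i j * dz i (fun x => holJac w x k l) y
      + ∑ i, dz l (fun x => Φ x i j) y * holJac w y k i := by
  have hwk := contDiffAt_coord hs hw hy k
  have h1 : dz l (dzbar j fun x => w x k) y
      = dz l (fun x => ∑ i, Φ x i j * dz i (fun x => w x k) x) y := by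
    refine dz_congr ?_ l
    filter_upwards [hs.mem_nhds hy] with x hx using ht x hx j k
  have hd (i : Fin n) : DifferentiableAt ℝ (dz i fun x => w x k) y :=
    (hasFDerivAt_dz hwk i).differentiableAt
  rw [dz_dzbar_comm hwk, dz_sum fun i _ => (hΦ i j).fun_mul (hd i)] at h1
  refine h1.trans ?_
  rw [← Finset.sum_add_distrib]
  refine Finset.sum_congr rfl fun i _ => ?_
  rw [dz_mul (hΦ i j) (hd i), dz_dz_comm hwk]
  simp only [holJac, Matrix.of_apply]
  ring

/-- `L_j (det (∂_l w^k)) = (∑_i ∂_i φ^i_{j̄}) det (∂_l w^k)`. -/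
theorem dzbar_det_holJac (hΦ : ∀ i j, DifferentiableAt ℝ (fun x => Φ x i j) y)
    (hs : IsOpen s) (hw : ContDiffOn ℝ ∞ w s) (hy : y ∈ s)
    (ht : ∀ x ∈ s, ∀ j k,
      dzbar j (fun x => w x k) x = ∑ i, Φ x i j * dz i (fun x => w x k) x)
    (j : Fin n) :
    dzbar j (fun x => (holJac w x).det) y = ∑ i, Φ y i j * dz i (fun x => (holJac w x).det) y
      + (holJac w y).det * ∑ i, dz i (fun x => Φ x i j) y := by
  have hN := differentiableAt_holJac hs hw hy
  rw [dzbar_det hN]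
  simp only [dzbar_holJac hΦ hs hw hy ht, dz_det hN, mul_add, Finset.sum_add_distrib,
    Finset.mul_sum]
  congr 1
  · rw [Finset.sum_congr rfl fun l _ => Finset.sum_comm, Finset.sum_comm]
    exact Finset.sum_congr rfl fun i _ => Finset.sum_congr rfl fun l _ =>
      Finset.sum_congr rfl fun k _ => by ring
  · refine Finset.sum_congr rfl fun l _ => ?_
    rw [Finset.sum_comm]
    have h (i : Fin n) : ∑ k, (holJac w y).adjugate l k *
          (dz l (fun x => Φ x i j) y * holJac w y k i)
        = dz l (fun x => Φ x i j) y * ((holJac w y).adjugate * holJac w y) l i := by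
      rw [Matrix.mul_apply, Finset.mul_sum]
      exact Finset.sum_congr rfl fun k _ => by ring
    simp only [h, Matrix.adjugate_mul, Matrix.smul_apply, Matrix.one_apply, smul_eq_mul]
    simp [mul_comm]

/-- If `f = q (det ∂w)^m`, then `f` satisfies the local equation exactly when the vector fields
`L_j` annihilate `q`. -/
theorem local_eq_iff_of_eq_mul_det_pow (hΦ : ∀ i j, DifferentiableAt ℝ (fun x => Φ x i j) y)
    (hs : IsOpen s) (hw : ContDiffOn ℝ ∞ w s) (hy : y ∈ s)
    (ht : ∀ x ∈ s, ∀ j k,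
      dzbar j (fun x => w x k) x = ∑ i, Φ x i j * dz i (fun x => w x k) x)
    (hD : (holJac w y).det ≠ 0) {f q : Cn n → ℂ} {m : ℕ} (hq : DifferentiableAt ℝ q y)
    (hf : f =ᶠ[nhds y] fun x => q x * (holJac w x).det ^ m) (j : Fin n) :
    dzbar j f y = ∑ i, Φ y i j * dz i f y + m * f y * ∑ i, dz i (fun x => Φ x i j) y
      ↔ dzbar j q y = ∑ i, Φ y i j * dz i q y := by
  set D : Cn n → ℂ := fun x => (holJac w x).det with hD_def
  have hDd : DifferentiableAt ℝ D y := differentiableAt_det (differentiableAt_holJac hs hw hy)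
  have hLD := dzbar_det_holJac hΦ hs hw hy ht j
  have hfd : fderiv ℝ f y
      = (D y ^ m) • fderiv ℝ q y + (q y * (m * D y ^ (m - 1))) • fderiv ℝ D y := by
    rw [hf.fderiv_eq, fderiv_fun_mul hq (hDd.fun_pow m), fderiv_fun_pow m hDd, add_comm]
    ext x
    simp
    ring
  have h1 : dzbar j f y = D y ^ m * dzbar j q y + q y * (m * D y ^ (m - 1)) * dzbar j D y := by
    simp [dzbar, hfd]
  have h2 (i : Fin n) :
      dz i f y = D y ^ m * dz i q y + q y * (m * D y ^ (m - 1)) * dz i D y := by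
    simp [dz, hfd]
  have h3 : ∑ i, Φ y i j * dz i f y = D y ^ m * ∑ i, Φ y i j * dz i q y
      + q y * (m * D y ^ (m - 1)) * ∑ i, Φ y i j * dz i D y := by
    simp only [h2, Finset.mul_sum, ← Finset.sum_add_distrib]
    exact Finset.sum_congr rfl fun i _ => by ring
  have hm : (m : ℂ) * D y ^ m = m * (D y ^ (m - 1) * D y) := by
    cases m with
    | zero => simp
    | succ m => rw [pow_succ]; rfl
  rw [h1, h3, hf.eq_of_nhds, hLD]
  have hDm : D y ^ m ≠ 0 := pow_ne_zero m hD
  constructor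
  · intro h
    apply mul_left_cancel₀ hDm
    linear_combination h + q y * (∑ i, dz i (fun x => Φ x i j) y) * hm
  · intro h
    linear_combination D y ^ m * h - q y * (∑ i, dz i (fun x => Φ x i j) y) * hm

/-- A function `q = h ∘ w` is annihilated by all the `L_j` exactly when the differential of `h` is
complex linear, that is, when `h` is holomorphic. -/
theorem dzbar_comp_eq_iff (hw : DifferentiableAt ℝ w y)
    (ht : ∀ j k, dzbar j (fun x => w x k) y = ∑ i, Φ y i j * dz i (fun x => w x k) y)
    (hsurj : Function.Surjective (fderiv ℝ w y)) {h : Cn n → ℂ}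
    (hh : DifferentiableAt ℝ h (w y)) :
    (∀ j, dzbar j (fun x => h (w x)) y = ∑ i, Φ y i j * dz i (fun x => h (w x)) y)
      ↔ DifferentiableAt ℂ h (w y) := by
  have hD := det_holJac_ne_zero hw ht hsurj
  set q : Cn n → ℂ := fun x => h (w x) with hq_def
  have hq : fderiv ℝ q y = (fderiv ℝ h (w y)).comp (fderiv ℝ w y) := fderiv_comp y hh hw
  rw [differentiableAt_iff_restrictScalars ℝ hh]
  constructor
  · intro hL
    -- `dq = ∑ ∂_i q e^i`, and `e = (∂w)⁻¹ dw`
    have h1 (v : Cn n) : fderiv ℝ q y v = (fun i => dz i q y) ⬝ᵥ fun i => coframe (Φ y) i v := by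
      rw [apply_eq_sum]
      change ∑ i, v i • dz i q y + ∑ j, (starRingEnd ℂ (v j)) • dzbar j q y = _
      simp only [hL, dotProduct, coframe, _root_.add_apply, dzCov_apply, comp01_apply, mul_add,
        Finset.sum_add_distrib, Finset.mul_sum, smul_eq_mul]
      congr 1
      · exact Finset.sum_congr rfl fun i _ => mul_comm _ _
      · rw [Finset.sum_comm]
        exact Finset.sum_congr rfl fun i _ => Finset.sum_congr rfl fun j _ => by ring
    let T : Cn n →L[ℂ] ℂ := LinearMap.toContinuousLinearMap
      { toFun := fun u => (fun i => dz i q y) ⬝ᵥ ((holJac w y)⁻¹ *ᵥ u)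
        map_add' := fun u u' => by rw [Matrix.mulVec_add, dotProduct_add]
        map_smul' := fun a u => by rw [Matrix.mulVec_smul, dotProduct_smul]; rfl }
    refine ⟨T, ?_⟩
    ext u
    obtain ⟨v, rfl⟩ := hsurj u
    have h2 := congrArg (fun L : Cn n →L[ℝ] ℂ => L v) hq
    simp only [ContinuousLinearMap.comp_apply] at h2
    rw [← h2, h1]
    change (fun i => dz i q y) ⬝ᵥ ((holJac w y)⁻¹ *ᵥ (fderiv ℝ w y v)) = _
    rw [fderiv_eq_holJac_mulVec hw ht, Matrix.mulVec_mulVec,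
      Matrix.nonsing_inv_mul _ (isUnit_iff_ne_zero.mpr hD), Matrix.one_mulVec]
  · rintro ⟨T, hT⟩ j
    have h1 : fderiv ℝ q y = ∑ k, T (stdVec k) • fderiv ℝ (fun x => w x k) y := by
      ext v
      rw [hq, ← hT]
      change T (fderiv ℝ w y v) = _
      conv_lhs => rw [eq_sum_smul_stdVec (fderiv ℝ w y v)]
      simp [fderiv_apply_apply hw, mul_comm]
    have h2 : dzbar j q y = ∑ k, T (stdVec k) * dzbar j (fun x => w x k) y := by
      simp [dzbar, h1]
    have h3 (i : Fin n) : dz i q y = ∑ k, T (stdVec k) * dz i (fun x => w x k) y := by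
      simp [dz, h1]
    simp only [h2, h3, ht, Finset.mul_sum]
    rw [Finset.sum_comm]
    exact Finset.sum_congr rfl fun i _ => Finset.sum_congr rfl fun k _ => by ring

end HolomorphicCoordinates

/-! ### Holomorphic sections in the coordinates of the deformed manifold -/

section Deformation

variable {n : ℕ} {M : Type*} [TopologicalSpace M] {c c' w : OpenPartialHomeomorph M (Cn n)}

/-- A chart of the deformed manifold, read in a chart of `M`. -/
def transition (w c : OpenPartialHomeomorph M (Cn n)) (y : Cn n) : Cn n := w (c.symm y)

theorem mem_source_of_mem_inter {x : M} (hx : x ∈ c.source ∩ w.source) :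
    c x ∈ (c.symm.trans w).source := by
  simp [hx.1, hx.2]

theorem target_of_mem_source {y : Cn n} (hy : y ∈ (c.symm.trans w).source) : y ∈ c.target := by
  simp only [OpenPartialHomeomorph.trans_source, OpenPartialHomeomorph.symm_source] at hy
  exact hy.1

theorem fderiv_changeOfChart_apply (i : Fin n) (y : Cn n) :
    fderiv ℂ (fun z => c' (c.symm z)) y (stdVec i) = fun l => jac c c' y l i := rfl

variable [ChartedSpace (Cn n) M] {φ : VectorForm n M} {A : ComplexStructure n M}

theorem IsDeformation.contDiffOn (hA : IsDeformation φ A) (hw : w ∈ A.charted.atlas)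
    (hc : c ∈ holCharts n M) : ContDiffOn ℝ ∞ (transition w c) (c.symm.trans w).source :=
  (hA.smooth w hw c hc).1

theorem IsDeformation.dzbar_transition (hA : IsDeformation φ A) (hw : w ∈ A.charted.atlas)
    (hc : c ∈ holCharts n M) {y : Cn n} (hy : y ∈ (c.symm.trans w).source) (j k : Fin n) :
    dzbar j (fun x => transition w c x k) y
      = ∑ i, φ.rep c y i j * dz i (fun x => transition w c x k) y :=
  hA.tangent w hw c hc y hy j k

theorem IsDeformation.differentiableAt_transition (hA : IsDeformation φ A)
    (hw : w ∈ A.charted.atlas) (hc : c ∈ holCharts n M) {y : Cn n}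
    (hy : y ∈ (c.symm.trans w).source) : DifferentiableAt ℝ (transition w c) y :=
  ((hA.contDiffOn hw hc).contDiffAt ((c.symm.trans w).open_source.mem_nhds hy)).differentiableAt
    (by simp)

/-- The charts of the deformed manifold are local diffeomorphisms of the smooth manifold `M`. -/
theorem IsDeformation.surjective_fderiv (hA : IsDeformation φ A) (hw : w ∈ A.charted.atlas)
    (hc : c ∈ holCharts n M) {y : Cn n} (hy : y ∈ (c.symm.trans w).source) :
    Function.Surjective (fderiv ℝ (transition w c) y) := by
  have hy' : y ∈ c.target ∧ c.symm y ∈ w.source := by simpa using hy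
  have hwy : transition w c y ∈ (w.symm.trans c).source := by
    simp [transition, hy'.1, hy'.2]
  have h1 := hA.differentiableAt_transition hw hc hy
  have h2 : DifferentiableAt ℝ (fun p => c (w.symm p)) (transition w c y) :=
    (((hA.smooth w hw c hc).2).contDiffAt
      ((w.symm.trans c).open_source.mem_nhds hwy)).differentiableAt (by simp)
  have h3 : (fun p => c (w.symm p)) ∘ transition w c =ᶠ[nhds y] id := by
    filter_upwards [(c.symm.trans w).open_source.mem_nhds hy] with x hx
    have hx' : x ∈ c.target ∧ c.symm x ∈ w.source := by simpa using hx
    simp [transition, hx'.1, hx'.2]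
  have h4 : (fderiv ℝ (fun p => c (w.symm p)) (transition w c y)).comp
      (fderiv ℝ (transition w c) y) = ContinuousLinearMap.id ℝ (Cn n) := by
    rw [← fderiv_comp y h2 h1, h3.fderiv_eq, fderiv_id]
  have h5 : Function.Injective (fderiv ℝ (transition w c) y : Cn n →ₗ[ℝ] Cn n) :=
    Function.LeftInverse.injective (g := fderiv ℝ (fun p => c (w.symm p)) (transition w c y))
      fun v => congrArg (fun L : Cn n →L[ℝ] Cn n => L v) h4
  exact LinearMap.injective_iff_surjective.mp h5

theorem IsDeformation.det_ne_zero (hA : IsDeformation φ A) (hw : w ∈ A.charted.atlas)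
    (hc : c ∈ holCharts n M) {y : Cn n} (hy : y ∈ (c.symm.trans w).source) :
    (holJac (transition w c) y).det ≠ 0 :=
  det_holJac_ne_zero (hA.differentiableAt_transition hw hc hy) (hA.dzbar_transition hw hc hy)
    (hA.surjective_fderiv hw hc hy)

/-- In a chart of `M`, `dw^1 ∧ ⋯ ∧ dw^n = det(∂w) e^1 ∧ ⋯ ∧ e^n`. -/
theorem IsDeformation.dW_eq (hA : IsDeformation φ A) (hw : w ∈ A.charted.atlas)
    (hc : c ∈ holCharts n M) {y : Cn n} (hy : y ∈ (c.symm.trans w).source) :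
    dW w c y = (holJac (transition w c) y).det • frame (φ.rep c y) :=
  dZ_comp_fderiv (hA.differentiableAt_transition hw hc hy) (hA.dzbar_transition hw hc hy)

/-- At a point, the section `ρ_φ(σ)` equals `a (dw^1 ∧ ⋯ ∧ dw^n)^{⊗ m}` exactly when its
coefficient is `a det(∂w)^m`. -/
theorem IsDeformation.rho_eq_smul_iff (hA : IsDeformation φ A) (hφ : φ.IsBeltrami)
    (hw : w ∈ A.charted.atlas) (hc : c ∈ holCharts n M) {m : ℕ} (σ : TwistedForm n M (m - 1) n)
    {y : Cn n} (hy : y ∈ (c.symm.trans w).source) (a : ℂ) :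
    rho φ m σ c y = a • PiTensorProduct.tprod ℂ (fun _ : Fin m => dW w c y)
      ↔ coeff (σ.rep c y) = a * (holJac (transition w c) y).det ^ m := by
  rw [hA.dW_eq hw hc hy, tprod_const_smul, smul_smul, rho]
  exact ⟨smul_tprod_const_injective (frame_ne_zero (hφ c hc y (target_of_mem_source hy))),
    fun h => by rw [h]⟩

/-! ### Change of the chart of `M` -/

theorem differentiableAt_changeOfChart (hc : c ∈ holCharts n M) (hc' : c' ∈ holCharts n M) {x : M}
    (hx : x ∈ c.source ∩ c'.source) : DifferentiableAt ℂ (fun z => c' (c.symm z)) (c x) := by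
  have h := (StructureGroupoid.compatible_of_mem_maximalAtlas hc hc')
  have h1 : ContDiffOn ℂ ω (c' ∘ c.symm) (c.symm.trans c').source := by
    rw [contDiffGroupoid, mem_groupoid_of_pregroupoid] at h
    simpa [contDiffPregroupoid] using h.1
  exact (h1.contDiffAt ((c.symm.trans c').open_source.mem_nhds
    (mem_source_of_mem_inter hx))).differentiableAt (by simp)

/-- One factor `det (∂z'/∂z)` comes from the form of type `(n,0)`, the other `r` from the values in
`K_M^{⊗ r}`. -/
theorem TwistedForm.coeff_changeOfChart {r : ℕ} {σ : TwistedForm n M r n} (hσ : σ.HasType n 0)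
    (hc : c ∈ holCharts n M) (hc' : c' ∈ holCharts n M) {x : M} (hx : x ∈ c.source ∩ c'.source) :
    coeff (σ.rep c (c x)) = (jac c c' (c x)).det ^ (r + 1) * coeff (σ.rep c' (c' x)) := by
  rw [σ.transform c hc c' hc' x hx, coeff_smul, TwistedForm.rep_eq hσ hc' (c'.map_source hx.2)]
  have h : coeff ((coeff (σ.rep c' (c' x)) • dZ n).compContinuousLinearMap
      ((fderiv ℂ (fun z => c' (c.symm z)) (c x)).restrictScalars ℝ))
      = coeff (σ.rep c' (c' x)) * (jac c c' (c x)).det := by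
    rw [← Matrix.det_transpose]
    rfl
  rw [h, coeff_smul, coeff_dZ]
  ring

theorem IsDeformation.det_changeOfChart (hA : IsDeformation φ A) (hw : w ∈ A.charted.atlas)
    (hc : c ∈ holCharts n M) (hc' : c' ∈ holCharts n M) {x : M}
    (hx : x ∈ c.source ∩ c'.source) (hxw : x ∈ w.source) :
    (holJac (transition w c) (c x)).det
      = (holJac (transition w c') (c' x)).det * (jac c c' (c x)).det := by
  rw [← Matrix.det_mul]
  congr 1
  ext k i
  have h1 : (fun y => transition w c y k)
      =ᶠ[nhds (c x)] (fun p => transition w c' p k) ∘ fun z => c' (c.symm z) := by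
    have h : (c.symm.trans c').source ∈ nhds (c x) :=
      (c.symm.trans c').open_source.mem_nhds (mem_source_of_mem_inter hx)
    filter_upwards [h] with z hz
    have hz' : z ∈ c.target ∧ c.symm z ∈ c'.source := by simpa using hz
    simp [transition, hz'.2]
  have hcx : c' (c.symm (c x)) = c' x := by rw [c.left_inv hx.1]
  have h2 := differentiableAt_changeOfChart hc hc' hx
  have h3 : DifferentiableAt ℝ (fun p => transition w c' p k) (c' (c.symm (c x))) := by
    rw [hcx]
    exact differentiableAt_pi.mp (hA.differentiableAt_transition hw hc'
      (mem_source_of_mem_inter ⟨hx.2, hxw⟩)) k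
  have h4 : fderiv ℝ (fun y => transition w c y k) (c x)
      = (fderiv ℝ (fun p => transition w c' p k) (c' x)).comp
        ((fderiv ℂ (fun z => c' (c.symm z)) (c x)).restrictScalars ℝ) := by
    rw [h1.fderiv_eq, fderiv_comp (c x) h3 (h2.restrictScalars ℝ), hcx,
      h2.fderiv_restrictScalars ℝ]
  have h5 (L : Cn n →L[ℝ] ℂ) (T : Cn n →L[ℂ] Cn n) (v : Cn n) :
      linPart (L.comp (T.restrictScalars ℝ)) v = linPart L (T v) := by
    simp [linPart_apply]
  rw [Matrix.mul_apply]
  change dz i (fun y => transition w c y k) (c x) = _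
  rw [dz, h4, h5, linPart_eq_sum, fderiv_changeOfChart_apply]
  exact Finset.sum_congr rfl fun l _ => mul_comm _ _

/-! ### Holomorphy and the local equation -/

/-- In a chart `w` of `M_φ`, the section is `h (dw^1 ∧ ⋯ ∧ dw^n)^{⊗ m}` with
`h ∘ w = f det(∂w)^{-m}`, and `f` satisfies the local equation exactly when the vector fields `L_j`
annihilate `h ∘ w`. -/
theorem isHolomorphicOn_source_iff_localEqOn (hφ : φ.IsBeltrami) (hA : IsDeformation φ A) {m : ℕ}
    (hm : 1 ≤ m) {σ : TwistedForm n M (m - 1) n} (hσ : σ.HasType n 0) (hc : c ∈ holCharts n M) :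
    IsHolomorphicOn A m (rho φ m σ) c.source ↔ LocalEqOn φ m σ c := by
  have hφd {y : Cn n} (hy : y ∈ c.target) := φ.differentiableAt hc hy
  constructor
  · intro h y hy
    have hx : c.symm y ∈ c.source := c.map_target hy
    -- a chart of the deformed manifold around the point
    obtain ⟨w, hw, hxw⟩ : ∃ w ∈ A.charted.atlas, c.symm y ∈ w.source :=
      ⟨_, A.charted.chart_mem_atlas _, A.charted.mem_chart_source _⟩
    obtain ⟨h, hh, heq⟩ := h w hw
    have hys : y ∈ (c.symm.trans w).source := by simp [hy, hxw]
    have hwy : transition w c y ∈ w.target ∩ w.symm ⁻¹' c.source := by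
      simp [transition, hxw, hx]
    have hhd : DifferentiableAt ℂ h (transition w c y) :=
      hh.differentiableAt ((w.isOpen_inter_preimage_symm c.open_source).mem_nhds hwy)
    have hwd := hA.differentiableAt_transition hw hc hys
    refine fun j => (local_eq_iff_of_eq_mul_det_pow (hφd hy) (c.symm.trans w).open_source
      (hA.contDiffOn hw hc) hys (fun x hx => hA.dzbar_transition hw hc hx)
      (hA.det_ne_zero hw hc hys) (q := fun x => h (transition w c x))
      ((hhd.restrictScalars ℝ).comp y hwd) ?_ j).mpr ?_
    · filter_upwards [(c.symm.trans w).open_source.mem_nhds hys] with x hx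
      have hx' : x ∈ c.target ∧ c.symm x ∈ w.source := by simpa using hx
      have h1 := heq c hc (c.symm x) ⟨c.map_target hx'.1, c.map_target hx'.1, hx'.2⟩
      rw [c.right_inv hx'.1] at h1
      exact (hA.rho_eq_smul_iff hφ hw hc σ hx _).mp h1
    · exact (dzbar_comp_eq_iff hwd (hA.dzbar_transition hw hc hys)
        (hA.surjective_fderiv hw hc hys) (hhd.restrictScalars ℝ)).mpr hhd j
  · intro hloc w hw
    let h : Cn n → ℂ := fun p => coeff (σ.rep c (c (w.symm p)))
      * ((holJac (transition w c) (c (w.symm p))).det ^ m)⁻¹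
    refine ⟨h, fun p hp => ?_, fun c' hc' x hx => ?_⟩
    · have hp' : w.symm p ∈ c.source ∩ w.source := ⟨hp.2, w.map_target hp.1⟩
      have hys : c (w.symm p) ∈ (c.symm.trans w).source := mem_source_of_mem_inter hp'
      have hyt : c (w.symm p) ∈ c.target := c.map_source hp.2
      have hwp : transition w c (c (w.symm p)) = p := by
        simp [transition, hp.1, hp'.1]
      have hps : p ∈ (w.symm.trans c).source := by simp [hp.1, hp'.1]
      have hcw : DifferentiableAt ℝ (fun p => c (w.symm p)) p :=
        (((hA.smooth w hw c hc).2).contDiffAt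
          ((w.symm.trans c).open_source.mem_nhds hps)).differentiableAt (by simp)
      have hD0 := hA.det_ne_zero hw hc hys
      have hD : DifferentiableAt ℝ (fun y => (holJac (transition w c) y).det) (c (w.symm p)) :=
        differentiableAt_det (differentiableAt_holJac (c.symm.trans w).open_source
          (hA.contDiffOn hw hc) hys)
      have hq : DifferentiableAt ℝ (fun y => coeff (σ.rep c y)
          * ((holJac (transition w c) y).det ^ m)⁻¹) (c (w.symm p)) :=
        (σ.differentiableAt_coeff hc hyt).fun_mul ((hD.fun_pow m).fun_inv (pow_ne_zero m hD0))
      have hhd : DifferentiableAt ℝ h p := DifferentiableAt.comp (g := fun y => coeff (σ.rep c y)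
        * ((holJac (transition w c) y).det ^ m)⁻¹) p hq hcw
      have hwd := hA.differentiableAt_transition hw hc hys
      have hnear : (fun y => coeff (σ.rep c y)) =ᶠ[nhds (c (w.symm p))]
          fun y => h (transition w c y) * (holJac (transition w c) y).det ^ m := by
        filter_upwards [(c.symm.trans w).open_source.mem_nhds hys] with y hy
        have hy' : y ∈ c.target ∧ c.symm y ∈ w.source := by simpa using hy
        have h1 : c (w.symm (transition w c y)) = y := by simp [transition, hy'.1, hy'.2]
        simp only [h, h1]
        rw [inv_mul_cancel_right₀ (pow_ne_zero m (hA.det_ne_zero hw hc hy))]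
      have hhd' : DifferentiableAt ℝ h (transition w c (c (w.symm p))) := by rwa [hwp]
      have h2 := (dzbar_comp_eq_iff hwd (hA.dzbar_transition hw hc hys)
        (hA.surjective_fderiv hw hc hys) hhd').mp fun j =>
          (local_eq_iff_of_eq_mul_det_pow (hφd hyt) (c.symm.trans w).open_source
            (hA.contDiffOn hw hc) hys (fun x hx => hA.dzbar_transition hw hc hx) hD0
            (hhd'.comp _ hwd) hnear j).mp (hloc _ hyt j)
      rw [hwp] at h2
      exact h2.differentiableWithinAt
    · rw [hA.rho_eq_smul_iff hφ hw hc' σ (mem_source_of_mem_inter hx.2)]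
      have hxc : x ∈ c.source ∩ c'.source := ⟨hx.1, hx.2.1⟩
      have hJ := hA.det_changeOfChart hw hc hc' hxc hx.2.2
      have hD0 := hA.det_ne_zero hw hc (mem_source_of_mem_inter ⟨hx.1, hx.2.2⟩)
      have hf := TwistedForm.coeff_changeOfChart hσ hc hc' hxc
      rw [Nat.sub_add_cancel hm] at hf
      simp only [h, w.left_inv hx.2.2]
      rw [hf, hJ]
      rw [hJ] at hD0
      have h1 := left_ne_zero_of_mul hD0
      have h2 := right_ne_zero_of_mul hD0
      field_simp
      ring

/-- Holomorphy on `M_φ` is local: the coefficients found over the charts of `M` agree, since they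
are determined by the section. -/
theorem isHolomorphicOn_univ_iff [IsManifold 𝓘(ℂ, Cn n) ω M] (hφ : φ.IsBeltrami)
    (hA : IsDeformation φ A) {m : ℕ} {σ : TwistedForm n M (m - 1) n} :
    IsHolomorphicOn A m (rho φ m σ) Set.univ
      ↔ ∀ c ∈ holCharts n M, IsHolomorphicOn A m (rho φ m σ) c.source := by
  constructor
  · intro h c _ w hw
    obtain ⟨h, hh, heq⟩ := h w hw
    exact ⟨h, hh.mono fun p hp => ⟨hp.1, trivial⟩, fun c' hc' x hx => heq c' hc' x ⟨trivial, hx.2⟩⟩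
  · intro h w hw
    have hchart (x : M) : chartAt (Cn n) x ∈ holCharts n M :=
      IsManifold.chart_mem_maximalAtlas x
    choose h hh heq using fun x : M => h (chartAt (Cn n) x) (hchart x) w hw
    have hagree (x x' : M) (hx : x ∈ w.source) (hx' : x ∈ (chartAt (Cn n) x').source) :
        h x (w x) = h x' (w x) := by
      have h1 := (hA.rho_eq_smul_iff hφ hw (hchart x) σ (mem_source_of_mem_inter
        ⟨mem_chart_source _ x, hx⟩) _).mp (heq x _ (hchart x) x
          ⟨mem_chart_source _ x, mem_chart_source _ x, hx⟩)
      have h2 := (hA.rho_eq_smul_iff hφ hw (hchart x) σ (mem_source_of_mem_inter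
        ⟨mem_chart_source _ x, hx⟩) _).mp (heq x' _ (hchart x) x
          ⟨hx', mem_chart_source _ x, hx⟩)
      exact mul_right_cancel₀ (pow_ne_zero m (hA.det_ne_zero hw (hchart x)
        (mem_source_of_mem_inter ⟨mem_chart_source _ x, hx⟩))) (h1.symm.trans h2)
    refine ⟨fun p => h (w.symm p) p, fun p hp => ?_, fun c hc x hx => ?_⟩
    · set x₀ := w.symm p
      have hp0 : p ∈ w.target ∩ w.symm ⁻¹' (chartAt (Cn n) x₀).source :=
        ⟨hp.1, mem_chart_source _ x₀⟩
      have hopen := w.isOpen_inter_preimage_symm (chartAt (Cn n) x₀).open_source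
      have h1 : DifferentiableAt ℂ (h x₀) p := (hh x₀).differentiableAt (hopen.mem_nhds hp0)
      refine (h1.congr_of_eventuallyEq ?_).differentiableWithinAt
      filter_upwards [hopen.mem_nhds hp0] with p' hp'
      have h2 := hagree (w.symm p') x₀ (w.map_target hp'.1) hp'.2
      rwa [w.right_inv hp'.1] at h2
    · have h1 := heq x c hc x ⟨mem_chart_source _ x, hx.2⟩
      beta_reduce
      rwa [w.left_inv hx.2.2]

end Deformation

end Pluricanonical

end

theorem mainTheorem10 {n : ℕ} {M : Type*} [TopologicalSpace M] [T2Space M] [CompactSpace M]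
    [ChartedSpace (Cn n) M] [IsManifold 𝓘(ℂ, Cn n) ω M]
    (g : KahlerMetric n M)
    (φ : VectorForm n M) (hφ : φ.IsBeltrami) (hint : φ.IsIntegrable)
    (m : ℕ) (hm : 2 ≤ m)
    (σ : TwistedForm n M (m - 1) n) (hσ : σ.HasType n 0) :
    -- the global equation, for any complex atlas of `M_φ`
    (∀ A : ComplexStructure n M, IsDeformation φ A →
      (IsHolomorphicOn A m (rho φ m σ) Set.univ ↔ ExtensionEq g φ m σ)) ∧
    -- the global equation, with holomorphy expressed by the `∂̄`-operator of `M_φ`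
    ((∀ c ∈ holCharts n M, IsDbarClosedOn φ m (rho φ m σ) c) ↔ ExtensionEq g φ m σ) ∧
    -- the local form in arbitrary holomorphic coordinates of `M`
    (∀ c ∈ holCharts n M,
      (∀ A : ComplexStructure n M, IsDeformation φ A →
        (IsHolomorphicOn A m (rho φ m σ) c.source ↔ LocalEqOn φ m σ c)) ∧
      (IsDbarClosedOn φ m (rho φ m σ) c ↔ LocalEqOn φ m σ c) ∧
      (ExtensionEqOn g φ m σ c ↔ LocalEqOn φ m σ c)) := by
  have hm1 : 1 ≤ m := by omega
  have hext (c) (hc : c ∈ holCharts n M) := extensionEqOn_iff_localEqOn g φ hm1 hσ hc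
  have hdbar (c) (hc : c ∈ holCharts n M) :=
    isDbarClosedOn_iff_localEqOn hφ hint (m := m) (σ := σ) hc
  have hhol (A) (hA : IsDeformation φ A) (c) (hc : c ∈ holCharts n M) :=
    isHolomorphicOn_source_iff_localEqOn hφ hA hm1 hσ hc
  refine ⟨fun A hA => ?_, ?_, fun c hc => ⟨fun A hA => hhol A hA c hc, hdbar c hc, hext c hc⟩⟩
  · rw [isHolomorphicOn_univ_iff hφ hA]
    exact forall₂_congr fun c hc => (hhol A hA c hc).trans (hext c hc).symm
  · exact forall₂_congr fun c hc => (hdbar c hc).trans (hext c hc).symm
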